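/- Let $m\ge 1$, let $E_1,\dots,E_m$ be (real) Riesz spaces and let $(\mathcal A,\ast)$ be an Archimedean $f$-algebra (associative, not assumed commutative or unital). For a Riesz space $E$ let $E^{\sim}$ be its order dual, that is, the Riesz space of all order bounded linear functionals on $E$, and let $E^{\sim\sim}=(E^{\sim})^{\sim}$. An $m$-linear operator between Riesz spaces is regular if it is a difference of two positive ones. A regular $m$-linear operator $B\colon E_1\times\cdots\times E_m\to\mathcal A$ is called multiplicative if there are regular linear operators $T_i\colon E_i\to\mathcal A$, $i=1,\dots,m$, such that $B(x_1,\dots,x_m)=T_1(x_1)\ast\cdots\ast T_m(x_m)$ for all $x_i\in E_i$. For a permutation $\rho$ of $\{1,\dots,m\}$, a regular $m$-linear operator $A\colon E_1\times\cdots\times E_m\to F$ into a Riesz space $F$, and $x_i''\in E_i^{\sim\sim}$, the Arens extension $AR_m^{\rho}(A)\colon E_1^{\sim\sim}\times\cdots\times E_m^{\sim\sim}\to F^{\sim\sim}$ is defined by $$AR_m^{\rho}(A)(x_1'',\dots,x_m'')(y')=\big(\overline{x_{\rho(m)}''}^{\rho}\circ\cdots\circ\overline{x_{\rho(1)}''}^{\rho}\big)(y'\circ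 A),\qquad y'\in F^{\sim},$$ where $\overline{x_{\rho(k)}''}^{\rho}$ sends a regular multilinear form $\Phi$ in the variables $x_i$, $i\notin\{\rho(1),\dots,\rho(k-1)\}$, to the regular multilinear form in the variables $x_i$, $i\notin\{\rho(1),\dots,\rho(k)\}$, whose value is $x_{\rho(k)}''$ applied to the functional that $\Phi$ induces on $E_{\rho(k)}$ when these variables are fixed (forms in no variables are scalars). If a regular $m$-linear operator $A\colon E_1\times\cdots\times E_m\to\mathcal A$ is a finite sum of multiplicative operators, then all Arens extensions of $A$ coincide, that is, $AR_m^{\rho}(A)=AR_m^{\sigma}(A)$ for all permutations $\rho,\sigma$ of $\{1,\dots,m\}$, and they are separately order continuous on $E_1^{\sim\sim}\times\cdots\times E_m^{\sim\sim}$: when all variables but one are fixed, the resulting linear operator $T\colon E_j^{\sim\sim}\to\mathcal A^{\sim\sim}$ maps nets that converge to $0$ in order to nets that converge to $0$ in order. This holds for each of the following three notions of order convergence of a net $(x_\alpha)_{\alpha\in\Omega}$ to $0$: (i) there is a net $(y_\alpha)_{\alpha\in\Omega}$ with $y_\alpha\downarrow 0$ and $|x_\alpha|\le y_\alpha$ for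 all $\alpha$; (ii) the same with $|x_\alpha|\le y_\alpha$ only for all $\alpha\ge\alpha_0$, for some $\alpha_0\in\Omega$; (iii) there is a net $(y_\beta)_{\beta\in\Gamma}$ with $y_\beta\downarrow 0$ such that for every $\beta$ there is $\alpha_0\in\Omega$ with $|x_\alpha|\le y_\beta$ for all $\alpha\ge\alpha_0$. -/

import Mathlib

open Set

universe u v w w'

/-! ## Riesz spaces and order convergence

A (real) Riesz space is a type with the instances
`[AddCommGroup E] [Lattice E] [IsOrderedAddMonoid E] [Module ℝ E] [IsOrderedModule ℝ E]`. -/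

section OrderConvergence

variable {E : Type*} [AddCommGroup E] [Lattice E]

/-- The net `y` is decreasing with infimum `0`, written `y_α ↓ 0`. -/
def DecreasesToZero {Ω : Type*} [Preorder Ω] (y : Ω → E) : Prop :=
  Antitone y ∧ IsGLB (range y) 0

/-- Order convergence: the dominating net has the same index set and dominates everywhere. -/
def OrderConverges {Ω : Type*} [Preorder Ω] (x : Ω → E) (a : E) : Prop :=
  ∃ y : Ω → E, DecreasesToZero y ∧ ∀ α, |x α - a| ≤ y α

/-- 1-convergence: the dominating net has the same index set and dominates eventually. -/
def OneConverges {Ω : Type*} [Preorder Ω] (x : Ω → E) (a : E) : Prop :=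
  ∃ (y : Ω → E) (α₀ : Ω), DecreasesToZero y ∧ ∀ α, α₀ ≤ α → |x α - a| ≤ y α

/-- 2-convergence: the dominating net may have another (directed) index set. -/
def TwoConverges {Ω : Type w} [Preorder Ω] (x : Ω → E) (a : E) : Prop :=
  ∃ (Γ : Type w') (_ : Preorder Γ) (_ : IsDirectedOrder Γ) (_ : Nonempty Γ) (y : Γ → E),
    DecreasesToZero y ∧ ∀ β, ∃ α₀ : Ω, ∀ α, α₀ ≤ α → |x α - a| ≤ y β

end OrderConvergence

section OrderContinuity

variable {E F : Type*} [AddCommGroup E] [Lattice E] [Module ℝ E]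
  [AddCommGroup F] [Lattice F] [Module ℝ F]

/-- `T` maps nets that order converge to `0` to nets that order converge to `0`. -/
def IsOrderContinuous (T : E →ₗ[ℝ] F) : Prop :=
  ∀ (Ω : Type w) [Preorder Ω] [IsDirectedOrder Ω] [Nonempty Ω] (x : Ω → E),
    OrderConverges x 0 → OrderConverges (fun α => T (x α)) 0

/-- `T` maps nets that 1-converge to `0` to nets that 1-converge to `0`. -/
def IsOneOrderContinuous (T : E →ₗ[ℝ] F) : Prop :=
  ∀ (Ω : Type w) [Preorder Ω] [IsDirectedOrder Ω] [Nonempty Ω] (x : Ω → E),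
    OneConverges x 0 → OneConverges (fun α => T (x α)) 0

/-- `T` maps nets that 2-converge to `0` to nets that 2-converge to `0`. -/
def IsTwoOrderContinuous (T : E →ₗ[ℝ] F) : Prop :=
  ∀ (Ω : Type w) [Preorder Ω] [IsDirectedOrder Ω] [Nonempty Ω] (x : Ω → E),
    TwoConverges.{w, w'} x 0 → TwoConverges.{w, w'} (fun α => T (x α)) 0

/-- A linear operator is regular if it is a difference of two positive linear operators. -/
def IsRegularLinear (T : E →ₗ[ℝ] F) : Prop :=
  ∃ P Q : E →ₗ[ℝ] F, (∀ x, 0 ≤ x → 0 ≤ P x) ∧ (∀ x, 0 ≤ x → 0 ≤ Q x) ∧ T = P - Q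

end OrderContinuity

section SeparateOrderContinuity

variable {ι : Type*} [DecidableEq ι] {E : ι → Type*} {F : Type*}
  [∀ i, AddCommGroup (E i)] [∀ i, Lattice (E i)] [∀ i, Module ℝ (E i)]
  [AddCommGroup F] [Lattice F] [Module ℝ F]

/-- All the linear operators obtained by fixing all but one variable are order continuous. -/
def IsSeparatelyOrderContinuous (A : MultilinearMap ℝ E F) : Prop :=
  ∀ (x : ∀ i, E i) (j : ι), IsOrderContinuous.{w} (A.toLinearMap x j)

/-- The same for 1-order continuity. -/
def IsSeparatelyOneOrderContinuous (A : MultilinearMap ℝ E F) : Prop :=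
  ∀ (x : ∀ i, E i) (j : ι), IsOneOrderContinuous.{w} (A.toLinearMap x j)

/-- The same for 2-order continuity. -/
def IsSeparatelyTwoOrderContinuous (A : MultilinearMap ℝ E F) : Prop :=
  ∀ (x : ∀ i, E i) (j : ι), IsTwoOrderContinuous.{w, w'} (A.toLinearMap x j)

end SeparateOrderContinuity

/-! ## The order dual -/

section Dual

variable (E : Type*) [AddCommGroup E] [Lattice E] [Module ℝ E]

/-- The order bounded linear functionals: those that map order intervals to bounded sets. -/
def orderBoundedFunctionals : Submodule ℝ (E →ₗ[ℝ] ℝ) where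
  carrier := {f | ∀ a b : E, ∃ M : ℝ, ∀ x ∈ Icc a b, |f x| ≤ M}
  add_mem' := by
    intro f g hf hg a b
    obtain ⟨M, hM⟩ := hf a b
    obtain ⟨N, hN⟩ := hg a b
    exact ⟨M + N, fun x hx => (abs_add_le _ _).trans (add_le_add (hM x hx) (hN x hx))⟩
  zero_mem' := fun a b => ⟨0, fun x _ => by simp⟩
  smul_mem' := by
    intro c f hf a b
    obtain ⟨M, hM⟩ := hf a b
    refine ⟨|c| * M, fun x hx => ?_⟩
    rw [LinearMap.smul_apply, smul_eq_mul, abs_mul]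
    exact mul_le_mul_of_nonneg_left (hM x hx) (abs_nonneg c)

/-- The order dual `E^∼` of a Riesz space `E`. -/
def RieszDual : Type _ := orderBoundedFunctionals E

noncomputable instance : AddCommGroup (RieszDual E) :=
  inferInstanceAs (AddCommGroup (orderBoundedFunctionals E))

noncomputable instance : Module ℝ (RieszDual E) :=
  inferInstanceAs (Module ℝ (orderBoundedFunctionals E))

end Dual

namespace RieszDual

set_option linter.unusedSectionVars false

variable {E : Type*} [AddCommGroup E] [Lattice E] [Module ℝ E]

instance : FunLike (RieszDual E) E ℝ where
  coe f := f.1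
  coe_injective _ _ h := Subtype.ext (LinearMap.ext fun x => congrFun h x)

instance : LinearMapClass (RieszDual E) ℝ E ℝ where
  map_add f := f.1.map_add
  map_smulₛₗ f := f.1.map_smul

/-- Bundle an order bounded linear functional. -/
def mk (f : E →ₗ[ℝ] ℝ) (hf : ∀ a b : E, ∃ M : ℝ, ∀ x ∈ Icc a b, |f x| ≤ M) : RieszDual E :=
  ⟨f, hf⟩

@[simp] theorem mk_apply (f : E →ₗ[ℝ] ℝ) (hf) (x : E) : mk f hf x = f x := rfl
@[ext] theorem ext {f g : RieszDual E} (h : ∀ x, f x = g x) : f = g := DFunLike.ext _ _ h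
@[simp] theorem add_apply (f g : RieszDual E) (x : E) : (f + g) x = f x + g x := rfl
@[simp] theorem sub_apply (f g : RieszDual E) (x : E) : (f - g) x = f x - g x := rfl
@[simp] theorem neg_apply (f : RieszDual E) (x : E) : (-f) x = -f x := rfl
@[simp] theorem zero_apply (x : E) : (0 : RieszDual E) x = 0 := rfl
@[simp] theorem smul_apply (c : ℝ) (f : RieszDual E) (x : E) : (c • f) x = c * f x := rfl

theorem bounded (f : RieszDual E) (a b : E) : ∃ M : ℝ, ∀ x ∈ Icc a b, |f x| ≤ M := f.2 a b

variable [IsOrderedAddMonoid E]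

/-- `f ≤ g` means that `f x ≤ g x` for all positive `x`. -/
instance : PartialOrder (RieszDual E) where
  le f g := ∀ x : E, 0 ≤ x → f x ≤ g x
  le_refl f x _ := le_rfl
  le_trans f g h h₁ h₂ x hx := (h₁ x hx).trans (h₂ x hx)
  le_antisymm f g h₁ h₂ := by
    ext x
    have key : ∀ y : E, 0 ≤ y → f y = g y := fun y hy => le_antisymm (h₁ y hy) (h₂ y hy)
    rw [← posPart_sub_negPart x, map_sub, map_sub, key _ (posPart_nonneg x),
      key _ (negPart_nonneg x)]

theorem le_def {f g : RieszDual E} : f ≤ g ↔ ∀ x : E, 0 ≤ x → f x ≤ g x := Iff.rfl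

theorem nonneg_apply {f : RieszDual E} (hf : 0 ≤ f) {x : E} (hx : 0 ≤ x) : 0 ≤ f x := hf x hx

theorem mono {f : RieszDual E} (hf : 0 ≤ f) {x y : E} (hxy : x ≤ y) : f x ≤ f y := by
  have := hf (y - x) (sub_nonneg.2 hxy)
  rw [map_sub] at this
  simpa using this

instance : IsOrderedAddMonoid (RieszDual E) where
  add_le_add_left f g h k x hx := by simpa using h x hx

/-- The Riesz-Kantorovich formula for the positive part, on the positive cone. -/
noncomputable def posAux (f : RieszDual E) (x : E) : ℝ := sSup (f '' Icc 0 x)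

theorem bddAbove (f : RieszDual E) (x : E) : BddAbove (f '' Icc 0 x) := by
  obtain ⟨M, hM⟩ := f.bounded 0 x
  refine ⟨M, ?_⟩
  rintro _ ⟨y, hy, rfl⟩
  exact (le_abs_self _).trans (hM y hy)

theorem le_posAux (f : RieszDual E) {x y : E} (hy : 0 ≤ y) (hyx : y ≤ x) : f y ≤ posAux f x :=
  le_csSup (f.bddAbove x) ⟨y, ⟨hy, hyx⟩, rfl⟩

theorem posAux_le (f : RieszDual E) {x : E} (hx : 0 ≤ x) {M : ℝ}
    (h : ∀ y, 0 ≤ y → y ≤ x → f y ≤ M) : posAux f x ≤ M := by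
  refine csSup_le ⟨_, ⟨0, ⟨le_rfl, hx⟩, rfl⟩⟩ ?_
  rintro _ ⟨y, hy, rfl⟩
  exact h y hy.1 hy.2

theorem posAux_nonneg (f : RieszDual E) {x : E} (hx : 0 ≤ x) : 0 ≤ posAux f x := by
  have := f.le_posAux (le_refl (0 : E)) hx
  rwa [map_zero] at this

theorem posAux_add (f : RieszDual E) {x y : E} (hx : 0 ≤ x) (hy : 0 ≤ y) :
    posAux f (x + y) = posAux f x + posAux f y := by
  apply le_antisymm
  · refine f.posAux_le (add_nonneg hx hy) fun z hz hzxy => ?_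
    have h1 : f (z ⊓ x) ≤ posAux f x := f.le_posAux (le_inf hz hx) inf_le_right
    have h2 : f (z - z ⊓ x) ≤ posAux f y := by
      refine f.le_posAux (sub_nonneg.2 inf_le_left) ?_
      rw [sub_le_iff_le_add, ← sub_le_iff_le_add']
      exact le_inf (by simpa using hy) (by rw [sub_le_iff_le_add]; exact hzxy)
    rw [map_sub] at h2
    linarith
  · rw [← le_sub_iff_add_le]
    refine f.posAux_le hx fun a ha hax => ?_
    rw [le_sub_comm]
    refine f.posAux_le hy fun b hb hby => ?_
    have := f.le_posAux (add_nonneg ha hb) (add_le_add hax hby)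
    rw [map_add] at this
    linarith

variable [IsOrderedModule ℝ E]

instance : IsOrderedModule ℝ (RieszDual E) where
  smul_le_smul_of_nonneg_left := by
    intro c hc f g h x hx
    exact mul_le_mul_of_nonneg_left (h x hx) hc
  smul_le_smul_of_nonneg_right := by
    intro f hf c d h x hx
    exact mul_le_mul_of_nonneg_right h (hf x hx)

theorem posAux_smul_le (f : RieszDual E) {c : ℝ} (hc : 0 < c) {x : E} (hx : 0 ≤ x) :
    posAux f (c • x) ≤ c * posAux f x := by
  refine f.posAux_le (smul_nonneg hc.le hx) fun y hy hyx => ?_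
  have h : f (c⁻¹ • y) ≤ posAux f x := by
    refine f.le_posAux (smul_nonneg (inv_nonneg.2 hc.le) hy) ?_
    have := smul_le_smul_of_nonneg_left hyx (inv_nonneg.2 hc.le)
    rwa [smul_smul, inv_mul_cancel₀ hc.ne', one_smul] at this
  rw [map_smul, smul_eq_mul] at h
  calc f y = c * (c⁻¹ * f y) := by field_simp
    _ ≤ c * posAux f x := mul_le_mul_of_nonneg_left h hc.le

theorem posAux_smul (f : RieszDual E) {c : ℝ} (hc : 0 < c) {x : E} (hx : 0 ≤ x) :
    posAux f (c • x) = c * posAux f x := by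
  refine le_antisymm (f.posAux_smul_le hc hx) ?_
  have h := f.posAux_smul_le (inv_pos.2 hc) (smul_nonneg hc.le hx)
  rw [smul_smul, inv_mul_cancel₀ hc.ne', one_smul] at h
  calc c * posAux f x ≤ c * (c⁻¹ * posAux f (c • x)) := mul_le_mul_of_nonneg_left h hc.le
    _ = posAux f (c • x) := by field_simp

theorem posAux_sub (f : RieszDual E) {a b c d : E} (ha : 0 ≤ a) (hb : 0 ≤ b) (hc : 0 ≤ c)
    (hd : 0 ≤ d) (h : a - b = c - d) :
    posAux f a - posAux f b = posAux f c - posAux f d := by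
  have h' : a + d = c + b := by rwa [sub_eq_sub_iff_add_eq_add] at h
  have := congrArg (posAux f) h'
  rw [f.posAux_add ha hd, f.posAux_add hc hb] at this
  linarith

/-- The positive part of an order bounded functional, as a linear functional. -/
noncomputable def posLin (f : RieszDual E) : E →ₗ[ℝ] ℝ where
  toFun x := posAux f x⁺ - posAux f x⁻
  map_add' x y := by
    have := f.posAux_sub (posPart_nonneg (x + y)) (negPart_nonneg (x + y))
      (add_nonneg (posPart_nonneg x) (posPart_nonneg y))
      (add_nonneg (negPart_nonneg x) (negPart_nonneg y))
      (by rw [posPart_sub_negPart, add_sub_add_comm, posPart_sub_negPart, posPart_sub_negPart])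
    rw [this, f.posAux_add (posPart_nonneg x) (posPart_nonneg y),
      f.posAux_add (negPart_nonneg x) (negPart_nonneg y)]
    ring
  map_smul' c x := by
    simp only [RingHom.id_apply, smul_eq_mul]
    rcases lt_trichotomy c 0 with hc | rfl | hc
    · have hc' : 0 < -c := neg_pos.2 hc
      have := f.posAux_sub (posPart_nonneg (c • x)) (negPart_nonneg (c • x))
        (smul_nonneg hc'.le (negPart_nonneg x)) (smul_nonneg hc'.le (posPart_nonneg x))
        (by rw [posPart_sub_negPart, ← smul_sub, ← neg_sub, posPart_sub_negPart, smul_neg,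
              neg_smul, neg_neg])
      rw [this, f.posAux_smul hc' (negPart_nonneg x), f.posAux_smul hc' (posPart_nonneg x)]
      ring
    · simp
    · have := f.posAux_sub (posPart_nonneg (c • x)) (negPart_nonneg (c • x))
        (smul_nonneg hc.le (posPart_nonneg x)) (smul_nonneg hc.le (negPart_nonneg x))
        (by rw [posPart_sub_negPart, ← smul_sub, posPart_sub_negPart])
      rw [this, f.posAux_smul hc (posPart_nonneg x), f.posAux_smul hc (negPart_nonneg x)]
      ring

theorem posLin_apply (f : RieszDual E) {x : E} (hx : 0 ≤ x) : posLin f x = posAux f x := by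
  have h0 : posAux f 0 = 0 := by
    refine le_antisymm (f.posAux_le le_rfl fun y hy hy' => ?_) (f.posAux_nonneg le_rfl)
    rw [le_antisymm hy' hy, map_zero]
  change posAux f x⁺ - posAux f x⁻ = _
  rw [posPart_of_nonneg hx, negPart_of_nonneg hx, h0, sub_zero]

/-- The positive part of an order bounded functional. -/
noncomputable def pos (f : RieszDual E) : RieszDual E :=
  mk (posLin f) (by
    intro a b
    refine ⟨posAux f (|a| + |b|), fun x hx => ?_⟩
    have hx' : |x| ≤ |a| + |b| := by
      rw [abs_le']
      constructor
      · exact hx.2.trans ((le_abs_self b).trans (le_add_of_nonneg_left (abs_nonneg a)))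
      · exact (neg_le_neg hx.1).trans
          ((neg_le_abs a).trans (le_add_of_nonneg_right (abs_nonneg b)))
    have h1 : posAux f x⁺ + posAux f x⁻ = posAux f |x| := by
      rw [← f.posAux_add (posPart_nonneg x) (negPart_nonneg x), posPart_add_negPart]
    have h2 : posAux f |x| ≤ posAux f (|a| + |b|) :=
      f.posAux_le (abs_nonneg x) fun y hy hyx => f.le_posAux hy (hyx.trans hx')
    have h3 := f.posAux_nonneg (posPart_nonneg x)
    have h4 := f.posAux_nonneg (negPart_nonneg x)
    change |posAux f x⁺ - posAux f x⁻| ≤ _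
    rw [abs_le]
    constructor <;> linarith)

theorem pos_apply (f : RieszDual E) {x : E} (hx : 0 ≤ x) : pos f x = posAux f x :=
  posLin_apply f hx

theorem le_pos (f : RieszDual E) : f ≤ pos f := fun x hx => by
  rw [pos_apply f hx]; exact f.le_posAux hx le_rfl

theorem pos_nonneg (f : RieszDual E) : 0 ≤ pos f := fun x hx => by
  rw [pos_apply f hx]; exact f.posAux_nonneg hx

theorem pos_le {f g : RieszDual E} (hfg : f ≤ g) (hg : 0 ≤ g) : pos f ≤ g := fun x hx => by
  rw [pos_apply f hx]
  exact f.posAux_le hx fun y hy hyx => (hfg y hy).trans (mono hg hyx)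

/-- The order dual of a Riesz space is a Riesz space for its order. -/
noncomputable instance : Lattice (RieszDual E) where
  sup f g := pos (f - g) + g
  le_sup_left f g := sub_le_iff_le_add.1 (le_pos (f - g))
  le_sup_right f g := le_add_of_nonneg_left (pos_nonneg (f - g))
  sup_le f g h hf hg := by
    rw [← le_sub_iff_add_le]
    exact pos_le (sub_le_sub_right hf g) (sub_nonneg.2 hg)
  inf f g := f - pos (f - g)
  inf_le_left f g := sub_le_self f (pos_nonneg (f - g))
  inf_le_right f g := by
    rw [sub_le_iff_le_add, ← sub_le_iff_le_add']
    exact le_pos (f - g)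
  le_inf f g h hf hg := by
    rw [le_sub_comm]
    exact pos_le (sub_le_sub_left hg g) (sub_nonneg.2 hf)

theorem abs_apply_le (f : RieszDual E) (x : E) : |f x| ≤ |f| |x| := by
  have h1 : ∀ y : E, 0 ≤ y → |f y| ≤ |f| y := fun y hy => by
    rw [abs_le']
    exact ⟨le_abs_self f y hy, neg_le_abs f y hy⟩
  calc |f x| = |f x⁺ - f x⁻| := by rw [← map_sub, posPart_sub_negPart]
    _ ≤ |f x⁺| + |f x⁻| := abs_sub _ _
    _ ≤ |f| x⁺ + |f| x⁻ := add_le_add (h1 _ (posPart_nonneg x)) (h1 _ (negPart_nonneg x))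
    _ = |f| |x| := by rw [← map_add, posPart_add_negPart]

end RieszDual

/-! ## Regular multilinear operators -/

section Regular

variable {ι : Type*} (E : ι → Type*) (F : Type*)
  [∀ i, AddCommGroup (E i)] [∀ i, Lattice (E i)] [∀ i, Module ℝ (E i)]
  [AddCommGroup F] [Lattice F] [IsOrderedAddMonoid F] [Module ℝ F] [IsOrderedModule ℝ F]

variable {E F} in
/-- A multilinear operator is positive if it maps tuples of positive vectors to positive vectors. -/
def IsPositiveMultilinear (A : MultilinearMap ℝ E F) : Prop :=
  ∀ x : ∀ i, E i, (∀ i, 0 ≤ x i) → 0 ≤ A x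

/-- The space of regular multilinear operators: the differences of two positive ones. -/
def RegularMultilinear : Submodule ℝ (MultilinearMap ℝ E F) where
  carrier := {A | ∃ P Q : MultilinearMap ℝ E F,
    IsPositiveMultilinear P ∧ IsPositiveMultilinear Q ∧ A = P - Q}
  add_mem' := by
    rintro _ _ ⟨P, Q, hP, hQ, rfl⟩ ⟨P', Q', hP', hQ', rfl⟩
    exact ⟨P + P', Q + Q', fun x hx => add_nonneg (hP x hx) (hP' x hx),
      fun x hx => add_nonneg (hQ x hx) (hQ' x hx), by abel⟩
  zero_mem' := ⟨0, 0, fun _ _ => le_rfl, fun _ _ => le_rfl, by simp⟩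
  smul_mem' := by
    rintro c _ ⟨P, Q, hP, hQ, rfl⟩
    rcases le_total 0 c with hc | hc
    · exact ⟨c • P, c • Q, fun x hx => smul_nonneg hc (hP x hx),
        fun x hx => smul_nonneg hc (hQ x hx), by rw [smul_sub]⟩
    · refine ⟨(-c) • Q, (-c) • P, fun x hx => smul_nonneg (neg_nonneg.2 hc) (hQ x hx),
        fun x hx => smul_nonneg (neg_nonneg.2 hc) (hP x hx), ?_⟩
      rw [smul_sub, neg_smul, neg_smul]
      abel

end Regular

namespace IsPositiveMultilinear

variable {ι : Type*} {E : ι → Type*} [∀ i, AddCommGroup (E i)] [∀ i, Lattice (E i)]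
  [∀ i, IsOrderedAddMonoid (E i)] [∀ i, Module ℝ (E i)]

theorem abs_apply_le [Finite ι] {P : MultilinearMap ℝ E ℝ} (hP : IsPositiveMultilinear P)
    (x : ∀ i, E i) : |P x| ≤ P fun i => |x i| := by
  classical
  have := Fintype.ofFinite ι
  suffices h : ∀ (t : Finset ι) (x : ∀ i, E i), (∀ i, i ∉ t → 0 ≤ x i) →
      |P x| ≤ P fun i => |x i| from h Finset.univ x (by simp)
  intro t
  induction t using Finset.induction_on with
  | empty =>
    intro x hx
    have hx' : ∀ i, 0 ≤ x i := fun i => hx i (by simp)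
    rw [abs_of_nonneg (hP x hx')]
    simp only [abs_of_nonneg (hx' _), le_refl]
  | insert j t _ ih =>
    intro x hx
    have hupd : ∀ z : E j, 0 ≤ z →
        |P (Function.update x j z)| ≤ P (Function.update (fun i => |x i|) j z) := by
      intro z hz
      refine (ih (Function.update x j z) ?_).trans (le_of_eq ?_)
      · intro i hi
        by_cases hij : i = j
        · subst hij; simpa using hz
        · rw [Function.update_of_ne hij]
          exact hx i (by simp [hij, hi])
      · congr 1
        ext i
        by_cases hij : i = j
        · subst hij; simp [abs_of_nonneg hz]
        · simp [Function.update_of_ne hij]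
    calc |P x| = |P (Function.update x j ((x j)⁺ - (x j)⁻))| := by
          rw [posPart_sub_negPart, Function.update_eq_self]
      _ = |P (Function.update x j (x j)⁺) - P (Function.update x j (x j)⁻)| := by
          rw [P.map_update_sub]
      _ ≤ _ := abs_sub _ _
      _ ≤ _ := add_le_add (hupd _ (posPart_nonneg _)) (hupd _ (negPart_nonneg _))
      _ = P (Function.update (fun i => |x i|) j ((x j)⁺ + (x j)⁻)) := by
          rw [P.map_update_add]
      _ = P fun i => |x i| := by
          rw [posPart_add_negPart]
          exact congrArg P (Function.update_eq_self j fun i => |x i|)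

end IsPositiveMultilinear

/-! ## Arens extensions -/

namespace Arens

variable {ι : Type*} [Finite ι] {E : ι → Type*}
  [∀ i, AddCommGroup (E i)] [∀ i, Lattice (E i)] [∀ i, IsOrderedAddMonoid (E i)]
  [∀ i, Module ℝ (E i)] [∀ i, IsOrderedModule ℝ (E i)]

/-- The space of regular multilinear forms in the variables whose index lies in `s`. -/
abbrev Forms (E : ι → Type*) [∀ i, AddCommGroup (E i)] [∀ i, Lattice (E i)]
    [∀ i, Module ℝ (E i)] (s : Set ι) :=
  RegularMultilinear (fun i : s => E i) ℝ

open Classical in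
/-- The tuple indexed by `s = t ∪ {j}` with entry `z` at `j` and the entries of `x` elsewhere. -/
noncomputable def fill {s t : Set ι} {j : ι} (hst : ∀ i ∈ s, i ≠ j → i ∈ t)
    (x : ∀ i : t, E i) (z : E j) : ∀ i : s, E i := fun i =>
  if h : (i : ι) = j then h.symm ▸ z else x ⟨i, hst i i.2 h⟩

set_option linter.unusedSectionVars false

section Eliminate

variable {s t : Set ι} {j : ι}

theorem fill_self (hst : ∀ i ∈ s, i ≠ j → i ∈ t) (hj : j ∈ s) (x : ∀ i : t, E i) (z : E j) :
    fill hst x z ⟨j, hj⟩ = z := by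
  simp [fill]

theorem fill_of_ne (hst : ∀ i ∈ s, i ≠ j → i ∈ t) (x : ∀ i : t, E i) (z : E j) (i : s)
    (hi : (i : ι) ≠ j) : fill hst x z i = x ⟨i, hst i i.2 hi⟩ := by
  simp [fill, hi]

theorem fill_eq_update [DecidableEq s] (hst : ∀ i ∈ s, i ≠ j → i ∈ t) (hj : j ∈ s)
    (x : ∀ i : t, E i) (z w : E j) :
    fill hst x w = Function.update (fill hst x z) ⟨j, hj⟩ w := by
  ext i
  by_cases hi : (i : ι) = j
  · obtain ⟨i, hi'⟩ := i
    subst hi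
    rw [fill_self, Function.update_self]
  · rw [fill_of_ne hst x w i hi, Function.update_of_ne (fun h => hi (congrArg Subtype.val h)),
      fill_of_ne hst x z i hi]

theorem fill_update [DecidableEq s] [DecidableEq t] (hst : ∀ i ∈ s, i ≠ j → i ∈ t)
    (hts : t ⊆ s) (hjt : j ∉ t) (x : ∀ i : t, E i) (z : E j) (k : t) (w : E k) :
    fill hst (Function.update x k w) z =
      Function.update (fill hst x z) (⟨k, hts k.2⟩ : s) w := by
  ext i
  by_cases hi : (i : ι) = j
  · obtain ⟨i, hi'⟩ := i
    subst hi
    rw [fill_self, Function.update_of_ne, fill_self]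
    intro h
    exact hjt ((congrArg Subtype.val h : i = k) ▸ k.2)
  · rw [fill_of_ne _ _ _ i hi]
    by_cases hik : (i : ι) = k
    · obtain ⟨i, hi'⟩ := i
      obtain ⟨k, hk⟩ := k
      subst hik
      rw [Function.update_self, Function.update_self]
    · rw [Function.update_of_ne (fun h => hik (congrArg Subtype.val h)),
        Function.update_of_ne (fun h => hik (congrArg Subtype.val h)), fill_of_ne _ _ _ i hi]

theorem fill_nonneg (hst : ∀ i ∈ s, i ≠ j → i ∈ t) {x : ∀ i : t, E i} (hx : ∀ i, 0 ≤ x i)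
    {z : E j} (hz : 0 ≤ z) (i : s) : 0 ≤ fill hst x z i := by
  by_cases hi : (i : ι) = j
  · obtain ⟨i, hi'⟩ := i
    subst hi
    rwa [fill_self]
  · rw [fill_of_ne _ _ _ i hi]
    exact hx ⟨i, hst i i.2 hi⟩

theorem abs_fill (hst : ∀ i ∈ s, i ≠ j → i ∈ t) (x : ∀ i : t, E i) (z : E j) :
    (fun i => |fill hst x z i|) = fill hst (fun i => |x i|) |z| := by
  ext i
  by_cases hi : (i : ι) = j
  · obtain ⟨i, hi'⟩ := i
    subst hi
    rw [fill_self, fill_self]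
  · rw [fill_of_ne _ _ _ i hi, fill_of_ne _ _ _ i hi]

/-- The linear functional on `E j` given by `A` when the variables in `t` are fixed. -/
noncomputable def sliceLin (hst : ∀ i ∈ s, i ≠ j → i ∈ t) (hj : j ∈ s)
    (A : MultilinearMap ℝ (fun i : s => E i) ℝ) (x : ∀ i : t, E i) : E j →ₗ[ℝ] ℝ where
  toFun z := A (fill hst x z)
  map_add' z w := by
    classical
    rw [fill_eq_update hst hj x 0 (z + w), fill_eq_update hst hj x 0 z,
      fill_eq_update hst hj x 0 w, A.map_update_add]
  map_smul' c z := by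
    classical
    rw [fill_eq_update hst hj x 0 (c • z), fill_eq_update hst hj x 0 z, A.map_update_smul]
    rfl

theorem sliceLin_bounded (hst : ∀ i ∈ s, i ≠ j → i ∈ t) (hj : j ∈ s)
    {A : MultilinearMap ℝ (fun i : s => E i) ℝ} (hA : IsPositiveMultilinear A)
    (x : ∀ i : t, E i) (a b : E j) : ∃ M : ℝ, ∀ z ∈ Icc a b, |sliceLin hst hj A x z| ≤ M := by
  refine ⟨sliceLin hst hj A (fun i => |x i|) (|a| + |b|), fun z hz => ?_⟩
  have hz' : |z| ≤ |a| + |b| := by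
    rw [abs_le']
    constructor
    · exact hz.2.trans ((le_abs_self b).trans (le_add_of_nonneg_left (abs_nonneg a)))
    · exact (neg_le_neg hz.1).trans
        ((neg_le_abs a).trans (le_add_of_nonneg_right (abs_nonneg b)))
  have h1 : |sliceLin hst hj A x z| ≤ sliceLin hst hj A (fun i => |x i|) |z| := by
    have := hA.abs_apply_le (fill hst x z)
    rwa [abs_fill] at this
  have h2 : 0 ≤ sliceLin hst hj A (fun i => |x i|) (|a| + |b| - |z|) :=
    hA _ (fill_nonneg hst (fun i => abs_nonneg _) (sub_nonneg.2 hz'))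
  rw [map_sub, sub_nonneg] at h2
  exact h1.trans h2

/-- The functional `A(…; • ; …)` with the dot at the coordinate `j`, an element of the order
dual of `E j`. -/
noncomputable def slice (hst : ∀ i ∈ s, i ≠ j → i ∈ t) (hj : j ∈ s)
    (A : Forms E s) (x : ∀ i : t, E i) : RieszDual (E j) :=
  RieszDual.mk (sliceLin hst hj A.1 x) (by
    obtain ⟨_, P, Q, hP, hQ, rfl⟩ := A
    have e : sliceLin hst hj (P - Q) x = sliceLin hst hj P x - sliceLin hst hj Q x := by
      ext z; rfl
    rw [e]
    exact (orderBoundedFunctionals (E j)).sub_mem (sliceLin_bounded hst hj hP x)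
      (sliceLin_bounded hst hj hQ x))

@[simp] theorem slice_apply (hst : ∀ i ∈ s, i ≠ j → i ∈ t) (hj : j ∈ s)
    (A : Forms E s) (x : ∀ i : t, E i) (z : E j) :
    slice hst hj A x z = A.1 (fill hst x z) := rfl

theorem slice_update_add [DecidableEq t] (hst : ∀ i ∈ s, i ≠ j → i ∈ t) (hj : j ∈ s)
    (hts : t ⊆ s) (hjt : j ∉ t) (A : Forms E s) (x : ∀ i : t, E i) (k : t) (v w : E k) :
    slice hst hj A (Function.update x k (v + w)) =
      slice hst hj A (Function.update x k v) + slice hst hj A (Function.update x k w) := by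
  classical
  ext z
  simp only [slice_apply, RieszDual.add_apply, fill_update hst hts hjt]
  exact A.1.map_update_add _ _ _ _

theorem slice_update_smul [DecidableEq t] (hst : ∀ i ∈ s, i ≠ j → i ∈ t) (hj : j ∈ s)
    (hts : t ⊆ s) (hjt : j ∉ t) (A : Forms E s) (x : ∀ i : t, E i) (k : t) (c : ℝ) (v : E k) :
    slice hst hj A (Function.update x k (c • v)) =
      c • slice hst hj A (Function.update x k v) := by
  classical
  ext z
  simp only [slice_apply, RieszDual.smul_apply, fill_update hst hts hjt]
  exact A.1.map_update_smul _ _ _ _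

/-- The multilinear form `x ↦ x''(A(x; • ; x))` in the variables indexed by `t`. -/
noncomputable def eliminateAux (hst : ∀ i ∈ s, i ≠ j → i ∈ t) (hj : j ∈ s)
    (hts : t ⊆ s) (hjt : j ∉ t) (x'' : RieszDual (RieszDual (E j))) (A : Forms E s) :
    MultilinearMap ℝ (fun i : t => E i) ℝ where
  toFun x := x'' (slice hst hj A x)
  map_update_add' x k v w := by rw [slice_update_add hst hj hts hjt, map_add]
  map_update_smul' x k c v := by rw [slice_update_smul hst hj hts hjt, map_smul]

theorem eliminateAux_pos (hst : ∀ i ∈ s, i ≠ j → i ∈ t) (hj : j ∈ s)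
    (hts : t ⊆ s) (hjt : j ∉ t) {x'' : RieszDual (RieszDual (E j))} (hx'' : 0 ≤ x'')
    {A : Forms E s} (hA : IsPositiveMultilinear A.1) :
    IsPositiveMultilinear (eliminateAux hst hj hts hjt x'' A) := fun _ hx =>
  hx'' _ fun _ hz => hA _ (fill_nonneg hst hx hz)

/-- Every `x''` in the second order dual of `E j` sends a regular form `A` in the variables
indexed by `s` to the regular form `x ↦ x''(A(x; • ; x))` in the variables indexed by
`t = s \ {j}`. -/
noncomputable def eliminate (hst : ∀ i ∈ s, i ≠ j → i ∈ t) (hj : j ∈ s)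
    (hts : t ⊆ s) (hjt : j ∉ t) (x'' : RieszDual (RieszDual (E j))) :
    Forms E s →ₗ[ℝ] Forms E t where
  toFun A := ⟨eliminateAux hst hj hts hjt x'' A, by
    obtain ⟨_, P, Q, hP, hQ, rfl⟩ := A
    have hP' : P ∈ RegularMultilinear (fun i : s => E i) ℝ :=
      ⟨P, 0, hP, fun _ _ => le_rfl, by simp⟩
    have hQ' : Q ∈ RegularMultilinear (fun i : s => E i) ℝ :=
      ⟨Q, 0, hQ, fun _ _ => le_rfl, by simp⟩
    refine ⟨eliminateAux hst hj hts hjt x''⁺ ⟨P, hP'⟩ + eliminateAux hst hj hts hjt x''⁻ ⟨Q, hQ'⟩,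
      eliminateAux hst hj hts hjt x''⁺ ⟨Q, hQ'⟩ + eliminateAux hst hj hts hjt x''⁻ ⟨P, hP'⟩,
      fun x hx => add_nonneg
        (eliminateAux_pos hst hj hts hjt (posPart_nonneg x'') (A := ⟨P, hP'⟩) hP x hx)
        (eliminateAux_pos hst hj hts hjt (negPart_nonneg x'') (A := ⟨Q, hQ'⟩) hQ x hx),
      fun x hx => add_nonneg
        (eliminateAux_pos hst hj hts hjt (posPart_nonneg x'') (A := ⟨Q, hQ'⟩) hQ x hx)
        (eliminateAux_pos hst hj hts hjt (negPart_nonneg x'') (A := ⟨P, hP'⟩) hP x hx), ?_⟩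
    ext x
    have e : slice hst hj ⟨P - Q, ⟨P, Q, hP, hQ, rfl⟩⟩ x =
        slice hst hj ⟨P, hP'⟩ x - slice hst hj ⟨Q, hQ'⟩ x := by ext z; rfl
    have e' : ∀ f : RieszDual (E j), x'' f = x''⁺ f - x''⁻ f := fun f => by
      rw [← RieszDual.sub_apply, posPart_sub_negPart]
    change x'' (slice hst hj ⟨P - Q, _⟩ x) =
      (x''⁺ (slice hst hj ⟨P, hP'⟩ x) + x''⁻ (slice hst hj ⟨Q, hQ'⟩ x)) -
      (x''⁺ (slice hst hj ⟨Q, hQ'⟩ x) + x''⁻ (slice hst hj ⟨P, hP'⟩ x))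
    rw [e, map_sub, e', e']
    ring⟩
  map_add' A B := by
    apply Subtype.ext
    ext x
    exact map_add x'' (slice hst hj A x) (slice hst hj B x)
  map_smul' c A := by
    apply Subtype.ext
    ext x
    exact map_smul x'' c (slice hst hj A x)

end Eliminate

section Extension

variable {m : ℕ} {E : Fin m → Type*}
  [∀ i, AddCommGroup (E i)] [∀ i, Lattice (E i)] [∀ i, IsOrderedAddMonoid (E i)]
  [∀ i, Module ℝ (E i)] [∀ i, IsOrderedModule ℝ (E i)]

/-- The indices that remain after the first `k` values of `ρ` have been removed. -/
def remaining (ρ : Equiv.Perm (Fin m)) (k : ℕ) : Set (Fin m) :=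
  {i | ∀ l : Fin m, (l : ℕ) < k → ρ l ≠ i}

/-- No index has been removed at the beginning. -/
def remainingZero (ρ : Equiv.Perm (Fin m)) : Fin m ≃ remaining ρ 0 where
  toFun i := ⟨i, fun _ h => absurd h (Nat.not_lt_zero _)⟩
  invFun i := i
  left_inv _ := rfl
  right_inv _ := rfl

/-- A regular form in all the variables, seen as a form in the variables `remaining ρ 0`. -/
noncomputable def start (ρ : Equiv.Perm (Fin m)) :
    RegularMultilinear E ℝ →ₗ[ℝ] Forms E (remaining ρ 0) where
  toFun Φ := ⟨MultilinearMap.domDomCongrLinearEquiv' ℝ ℝ E ℝ (remainingZero ρ) Φ.1, by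
    obtain ⟨_, P, Q, hP, hQ, rfl⟩ := Φ
    exact ⟨MultilinearMap.domDomCongrLinearEquiv' ℝ ℝ E ℝ (remainingZero ρ) P,
      MultilinearMap.domDomCongrLinearEquiv' ℝ ℝ E ℝ (remainingZero ρ) Q,
      fun x hx => hP _ fun i => hx (remainingZero ρ i),
      fun x hx => hQ _ fun i => hx (remainingZero ρ i), map_sub _ _ _⟩⟩
  map_add' _ _ := rfl
  map_smul' _ _ := rfl

theorem start_apply (ρ : Equiv.Perm (Fin m)) (Φ : RegularMultilinear E ℝ)
    (x : ∀ i : remaining ρ 0, E i) : (start ρ Φ).1 x = Φ.1 fun i => x (remainingZero ρ i) := rfl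

theorem mem_of_remaining (ρ : Equiv.Perm (Fin m)) (k : Fin m) (i : Fin m)
    (hi : i ∈ remaining ρ k) (hne : i ≠ ρ k) : i ∈ remaining ρ (k + 1) := by
  intro l hl
  rcases Nat.lt_succ_iff_lt_or_eq.1 hl with h | h
  · exact hi l h
  · rw [Fin.ext h]; exact hne.symm

theorem mem_remaining (ρ : Equiv.Perm (Fin m)) (k : Fin m) : ρ k ∈ remaining ρ k := by
  intro l hl h
  rw [ρ.injective h] at hl
  exact lt_irrefl _ hl

theorem remaining_subset (ρ : Equiv.Perm (Fin m)) (k : ℕ) :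
    remaining ρ (k + 1) ⊆ remaining ρ k := fun _ hi l hl => hi l (hl.trans (Nat.lt_succ_self k))

theorem notMem_remaining (ρ : Equiv.Perm (Fin m)) (k : Fin m) : ρ k ∉ remaining ρ (k + 1) :=
  fun h => h k (Nat.lt_succ_self _) rfl

/-- The operator induced by an element of the second order dual of `E (ρ k)`, from the regular
forms with the variables `ρ 0, …, ρ (k - 1)` removed to those with `ρ 0, …, ρ k` removed. -/
noncomputable def step (ρ : Equiv.Perm (Fin m)) (k : Fin m)
    (x'' : RieszDual (RieszDual (E (ρ k)))) :
    Forms E (remaining ρ k) →ₗ[ℝ] Forms E (remaining ρ (k + 1)) :=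
  eliminate (mem_of_remaining ρ k) (mem_remaining ρ k) (remaining_subset ρ k)
    (notMem_remaining ρ k) x''

theorem step_apply (ρ : Equiv.Perm (Fin m)) (k : Fin m) (x'' : RieszDual (RieszDual (E (ρ k))))
    (A : Forms E (remaining ρ k)) (x : ∀ i : remaining ρ (k + 1), E i) :
    (step ρ k x'' A).1 x = x'' (slice (mem_of_remaining ρ k) (mem_remaining ρ k) A x) := rfl

theorem step_add (ρ : Equiv.Perm (Fin m)) (k : Fin m) (x'' y'' : RieszDual (RieszDual (E (ρ k)))) :
    step ρ k (x'' + y'') = step ρ k x'' + step ρ k y'' := rfl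

theorem step_smul (ρ : Equiv.Perm (Fin m)) (k : Fin m) (c : ℝ)
    (x'' : RieszDual (RieszDual (E (ρ k)))) :
    step ρ k (c • x'') = c • step ρ k x'' := rfl

theorem step_pos (ρ : Equiv.Perm (Fin m)) (k : Fin m) {x'' : RieszDual (RieszDual (E (ρ k)))}
    (hx'' : 0 ≤ x'') {A : Forms E (remaining ρ k)} (hA : IsPositiveMultilinear A.1) :
    IsPositiveMultilinear (step ρ k x'' A).1 :=
  eliminateAux_pos (mem_of_remaining ρ k) (mem_remaining ρ k) (remaining_subset ρ k)
    (notMem_remaining ρ k) hx'' hA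

/-- The composition of the operators induced by `x'' (ρ 0), …, x'' (ρ (k - 1))`, in this order
(the one of `x'' (ρ 0)` is applied first). -/
noncomputable def stage (ρ : Equiv.Perm (Fin m)) (x'' : ∀ i, RieszDual (RieszDual (E i))) :
    (k : ℕ) → k ≤ m → (RegularMultilinear E ℝ →ₗ[ℝ] Forms E (remaining ρ k))
  | 0, _ => start ρ
  | k + 1, hk => step ρ ⟨k, hk⟩ (x'' (ρ ⟨k, hk⟩)) ∘ₗ stage ρ x'' k (Nat.le_of_succ_le hk)

theorem stage_succ (ρ : Equiv.Perm (Fin m)) (x'' : ∀ i, RieszDual (RieszDual (E i)))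
    (k : ℕ) (hk : k + 1 ≤ m) : stage ρ x'' (k + 1) hk =
      step ρ ⟨k, hk⟩ (x'' (ρ ⟨k, hk⟩)) ∘ₗ stage ρ x'' k (Nat.le_of_succ_le hk) := rfl

theorem stage_pos (ρ : Equiv.Perm (Fin m)) {x'' : ∀ i, RieszDual (RieszDual (E i))}
    (hx'' : ∀ i, 0 ≤ x'' i) {Φ : RegularMultilinear E ℝ} (hΦ : IsPositiveMultilinear Φ.1)
    (k : ℕ) (hk : k ≤ m) : IsPositiveMultilinear (stage ρ x'' k hk Φ).1 := by
  induction k with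
  | zero => exact fun x hx => hΦ _ fun i => hx (remainingZero ρ i)
  | succ k ih => exact step_pos ρ ⟨k, hk⟩ (hx'' _) (ih _)

theorem stage_congr (ρ : Equiv.Perm (Fin m)) {x'' y'' : ∀ i, RieszDual (RieszDual (E i))}
    (k : ℕ) (hk : k ≤ m) (h : ∀ l : Fin m, (l : ℕ) < k → x'' (ρ l) = y'' (ρ l)) :
    stage ρ x'' k hk = stage ρ y'' k hk := by
  induction k with
  | zero => rfl
  | succ k ih =>
    rw [stage_succ, stage_succ, h ⟨k, hk⟩ (Nat.lt_succ_self k),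
      ih (Nat.le_of_succ_le hk) fun l hl => h l (hl.trans (Nat.lt_succ_self k))]

theorem stage_update_add (ρ : Equiv.Perm (Fin m)) (x'' : ∀ i, RieszDual (RieszDual (E i)))
    (j : Fin m) (v w : RieszDual (RieszDual (E (ρ j)))) (k : ℕ) (hk : k ≤ m) (hj : (j : ℕ) < k) :
    stage ρ (Function.update x'' (ρ j) (v + w)) k hk =
      stage ρ (Function.update x'' (ρ j) v) k hk +
        stage ρ (Function.update x'' (ρ j) w) k hk := by
  induction k with
  | zero => exact absurd hj (Nat.not_lt_zero _)
  | succ k ih =>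
    simp only [stage_succ]
    rcases Nat.lt_succ_iff_lt_or_eq.1 hj with h | h
    · have hne : ρ ⟨k, hk⟩ ≠ ρ j := fun e => by
        have := congrArg Fin.val (ρ.injective e)
        exact absurd this.symm h.ne
      rw [ih _ h, LinearMap.comp_add]
      simp only [Function.update_of_ne hne]
    · have hkj : (⟨k, hk⟩ : Fin m) = j := Fin.ext h.symm
      have hc : ∀ u v, stage ρ (Function.update x'' (ρ j) u) k (Nat.le_of_succ_le hk) =
          stage ρ (Function.update x'' (ρ j) v) k (Nat.le_of_succ_le hk) := fun u v =>
        stage_congr ρ k _ fun l hl => by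
          have hne : ρ l ≠ ρ j := fun e => by
            have := congrArg Fin.val (ρ.injective e)
            omega
          rw [Function.update_of_ne hne, Function.update_of_ne hne]
      subst hkj
      rw [hc (v + w) v, hc w v]
      simp only [Function.update_self, step_add, LinearMap.add_comp]

theorem stage_update_smul (ρ : Equiv.Perm (Fin m)) (x'' : ∀ i, RieszDual (RieszDual (E i)))
    (j : Fin m) (c : ℝ) (v : RieszDual (RieszDual (E (ρ j)))) (k : ℕ) (hk : k ≤ m)
    (hj : (j : ℕ) < k) :
    stage ρ (Function.update x'' (ρ j) (c • v)) k hk =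
      c • stage ρ (Function.update x'' (ρ j) v) k hk := by
  induction k with
  | zero => exact absurd hj (Nat.not_lt_zero _)
  | succ k ih =>
    simp only [stage_succ]
    rcases Nat.lt_succ_iff_lt_or_eq.1 hj with h | h
    · have hne : ρ ⟨k, hk⟩ ≠ ρ j := fun e => by
        have := congrArg Fin.val (ρ.injective e)
        exact absurd this.symm h.ne
      rw [ih _ h, LinearMap.comp_smul]
      simp only [Function.update_of_ne hne]
    · have hkj : (⟨k, hk⟩ : Fin m) = j := Fin.ext h.symm
      have hc : ∀ u v, stage ρ (Function.update x'' (ρ j) u) k (Nat.le_of_succ_le hk) =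
          stage ρ (Function.update x'' (ρ j) v) k (Nat.le_of_succ_le hk) := fun u v =>
        stage_congr ρ k _ fun l hl => by
          have hne : ρ l ≠ ρ j := fun e => by
            have := congrArg Fin.val (ρ.injective e)
            omega
          rw [Function.update_of_ne hne, Function.update_of_ne hne]
      subst hkj
      rw [hc (c • v) v]
      simp only [Function.update_self, step_smul, LinearMap.smul_comp]

/-- After `m` steps no variable is left. -/
theorem isEmpty_remaining (ρ : Equiv.Perm (Fin m)) : IsEmpty (remaining ρ m) :=
  ⟨fun i => i.2 (ρ.symm i) (ρ.symm i).2 (ρ.apply_symm_apply i)⟩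

/-- The scalar obtained from the form `Φ` by applying the operators induced by
`x'' (ρ 0), …, x'' (ρ (m - 1))`, in this order. The last form has no variables: it is identified
with its value at the empty tuple. -/
noncomputable def value (ρ : Equiv.Perm (Fin m)) (Φ : RegularMultilinear E ℝ) :
    MultilinearMap ℝ (fun i => RieszDual (RieszDual (E i))) ℝ where
  toFun x'' := (stage ρ x'' m le_rfl Φ).1 (isEmpty_remaining ρ).elim
  map_update_add' := by
    intro inst x'' j v w
    obtain ⟨j, rfl⟩ := ρ.surjective j
    obtain rfl : inst = instDecidableEqFin m := Subsingleton.elim _ _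
    rw [stage_update_add ρ x'' j v w m le_rfl j.2]
    rfl
  map_update_smul' := by
    intro inst x'' j c v
    obtain ⟨j, rfl⟩ := ρ.surjective j
    obtain rfl : inst = instDecidableEqFin m := Subsingleton.elim _ _
    rw [stage_update_smul ρ x'' j c v m le_rfl j.2]
    rfl

theorem value_apply (ρ : Equiv.Perm (Fin m)) (Φ : RegularMultilinear E ℝ)
    (x'' : ∀ i, RieszDual (RieszDual (E i))) :
    value ρ Φ x'' = (stage ρ x'' m le_rfl Φ).1 (isEmpty_remaining ρ).elim := rfl

theorem value_pos (ρ : Equiv.Perm (Fin m)) {Φ : RegularMultilinear E ℝ}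
    (hΦ : IsPositiveMultilinear Φ.1) : IsPositiveMultilinear (value ρ Φ) := fun _ hx'' =>
  stage_pos ρ hx'' hΦ m le_rfl _ fun i => (isEmpty_remaining ρ).elim i

theorem value_add (ρ : Equiv.Perm (Fin m)) (Φ Ψ : RegularMultilinear E ℝ)
    (x'' : ∀ i, RieszDual (RieszDual (E i))) :
    value ρ (Φ + Ψ) x'' = value ρ Φ x'' + value ρ Ψ x'' := by
  simp only [value_apply, map_add]
  rfl

theorem value_smul (ρ : Equiv.Perm (Fin m)) (c : ℝ) (Φ : RegularMultilinear E ℝ)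
    (x'' : ∀ i, RieszDual (RieszDual (E i))) :
    value ρ (c • Φ) x'' = c * value ρ Φ x'' := by
  simp only [value_apply, map_smul]
  rfl

variable {F : Type*} [AddCommGroup F] [Lattice F] [IsOrderedAddMonoid F] [Module ℝ F]
  [IsOrderedModule ℝ F]

/-- The regular form `y' ∘ A`. -/
noncomputable def compose (A : RegularMultilinear E F) :
    RieszDual F →ₗ[ℝ] RegularMultilinear E ℝ where
  toFun y' := ⟨(y' : F →ₗ[ℝ] ℝ).compMultilinearMap A.1, by
    obtain ⟨_, P, Q, hP, hQ, rfl⟩ := A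
    refine ⟨((y'⁺ : RieszDual F) : F →ₗ[ℝ] ℝ).compMultilinearMap P +
        ((y'⁻ : RieszDual F) : F →ₗ[ℝ] ℝ).compMultilinearMap Q,
      ((y'⁺ : RieszDual F) : F →ₗ[ℝ] ℝ).compMultilinearMap Q +
        ((y'⁻ : RieszDual F) : F →ₗ[ℝ] ℝ).compMultilinearMap P,
      fun x hx => add_nonneg (posPart_nonneg y' _ (hP x hx)) (negPart_nonneg y' _ (hQ x hx)),
      fun x hx => add_nonneg (posPart_nonneg y' _ (hQ x hx)) (negPart_nonneg y' _ (hP x hx)), ?_⟩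
    ext x
    have e : ∀ z : F, y' z = y'⁺ z - y'⁻ z := fun z => by
      rw [← RieszDual.sub_apply, posPart_sub_negPart]
    change y' (P x - Q x) = (y'⁺ (P x) + y'⁻ (Q x)) - (y'⁺ (Q x) + y'⁻ (P x))
    rw [map_sub, e, e]
    ring⟩
  map_add' _ _ := rfl
  map_smul' _ _ := rfl

@[simp] theorem compose_apply (A : RegularMultilinear E F) (y' : RieszDual F) (x : ∀ i, E i) :
    (compose A y').1 x = y' (A.1 x) := rfl

/-- The functional `y' ↦ value ρ (y' ∘ A) x''` on the order dual of `F`. -/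
noncomputable def functional (ρ : Equiv.Perm (Fin m)) (A : RegularMultilinear E F)
    (x'' : ∀ i, RieszDual (RieszDual (E i))) : RieszDual F →ₗ[ℝ] ℝ where
  toFun y' := value ρ (compose A y') x''
  map_add' y' z' := by rw [map_add, value_add]
  map_smul' c y' := by rw [map_smul, value_smul]; rfl

theorem functional_bounded_of_pos (ρ : Equiv.Perm (Fin m)) {A : RegularMultilinear E F}
    (hA : IsPositiveMultilinear A.1) (x'' : ∀ i, RieszDual (RieszDual (E i)))
    (a b : RieszDual F) : ∃ M : ℝ, ∀ y' ∈ Icc a b, |functional ρ A x'' y'| ≤ M := by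
  have hpos : ∀ y' : RieszDual F, 0 ≤ y' → IsPositiveMultilinear (compose A y').1 :=
    fun y' hy' x hx => hy' _ (hA x hx)
  refine ⟨functional ρ A (fun i => |x'' i|) (|a| + |b|), fun y' hy' => ?_⟩
  have hy'' : |y'| ≤ |a| + |b| := by
    rw [abs_le']
    constructor
    · exact hy'.2.trans ((le_abs_self b).trans (le_add_of_nonneg_left (abs_nonneg a)))
    · exact (neg_le_neg hy'.1).trans
        ((neg_le_abs a).trans (le_add_of_nonneg_right (abs_nonneg b)))
  have h1 : ∀ z' : RieszDual F, 0 ≤ z' →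
      |functional ρ A x'' z'| ≤ functional ρ A (fun i => |x'' i|) z' := fun z' hz' =>
    (value_pos ρ (hpos z' hz')).abs_apply_le x''
  have h2 : 0 ≤ functional ρ A (fun i => |x'' i|) (|a| + |b| - |y'|) :=
    value_pos ρ (hpos _ (sub_nonneg.2 hy'')) _ fun i => abs_nonneg (x'' i)
  rw [map_sub, sub_nonneg] at h2
  calc |functional ρ A x'' y'| = |functional ρ A x'' y'⁺ - functional ρ A x'' y'⁻| := by
        rw [← map_sub, posPart_sub_negPart]
    _ ≤ |functional ρ A x'' y'⁺| + |functional ρ A x'' y'⁻| := abs_sub _ _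
    _ ≤ functional ρ A (fun i => |x'' i|) y'⁺ + functional ρ A (fun i => |x'' i|) y'⁻ :=
        add_le_add (h1 _ (posPart_nonneg _)) (h1 _ (negPart_nonneg _))
    _ = functional ρ A (fun i => |x'' i|) |y'| := by rw [← map_add, posPart_add_negPart]
    _ ≤ _ := h2

theorem functional_bounded (ρ : Equiv.Perm (Fin m)) (A : RegularMultilinear E F)
    (x'' : ∀ i, RieszDual (RieszDual (E i))) (a b : RieszDual F) :
    ∃ M : ℝ, ∀ y' ∈ Icc a b, |functional ρ A x'' y'| ≤ M := by
  obtain ⟨_, P, Q, hP, hQ, rfl⟩ := A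
  have hP' : P ∈ RegularMultilinear E F := ⟨P, 0, hP, fun _ _ => le_rfl, by simp⟩
  have hQ' : Q ∈ RegularMultilinear E F := ⟨Q, 0, hQ, fun _ _ => le_rfl, by simp⟩
  have e : functional ρ ⟨P - Q, ⟨P, Q, hP, hQ, rfl⟩⟩ x'' =
      functional ρ ⟨P, hP'⟩ x'' - functional ρ ⟨Q, hQ'⟩ x'' := by
    ext y'
    have h : compose ⟨P - Q, ⟨P, Q, hP, hQ, rfl⟩⟩ y' + compose ⟨Q, hQ'⟩ y' =
        compose (⟨P, hP'⟩ : RegularMultilinear E F) y' := by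
      apply Subtype.ext
      ext x
      change y' (P x - Q x) + y' (Q x) = y' (P x)
      rw [map_sub, sub_add_cancel]
    change value ρ _ x'' = value ρ _ x'' - value ρ _ x''
    rw [← h, value_add, add_sub_cancel_right]
  rw [e]
  exact (orderBoundedFunctionals (RieszDual F)).sub_mem
    (functional_bounded_of_pos ρ (A := ⟨P, hP'⟩) hP x'')
    (functional_bounded_of_pos ρ (A := ⟨Q, hQ'⟩) hQ x'') a b

/-- The Arens extension of the regular `m`-linear operator `A` with respect to the permutation
`ρ`: it sends `x''` to the functional `y' ↦ (x''_{ρ(m)} ∘ ⋯ ∘ x''_{ρ(1)}) (y' ∘ A)`, where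
`x''_{ρ(k)}` stands for the operator `step` that it induces. -/
noncomputable def extension (ρ : Equiv.Perm (Fin m)) (A : RegularMultilinear E F) :
    MultilinearMap ℝ (fun i => RieszDual (RieszDual (E i))) (RieszDual (RieszDual F)) where
  toFun x'' := RieszDual.mk (functional ρ A x'') (functional_bounded ρ A x'')
  map_update_add' x'' j v w := by
    ext y'
    exact (value ρ (compose A y')).map_update_add x'' j v w
  map_update_smul' x'' j c v := by
    ext y'
    exact (value ρ (compose A y')).map_update_smul x'' j c v

theorem extension_apply (ρ : Equiv.Perm (Fin m)) (A : RegularMultilinear E F)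
    (x'' : ∀ i, RieszDual (RieszDual (E i))) (y' : RieszDual F) :
    extension ρ A x'' y' =
      (stage ρ x'' m le_rfl (compose A y')).1 (isEmpty_remaining ρ).elim := rfl

end Extension

end Arens

/-! ## Archimedean `f`-algebras and multiplicative operators

A Riesz algebra has, besides the instances of a Riesz space, the instances
`[NonUnitalRing 𝒜] [IsScalarTower ℝ 𝒜 𝒜] [SMulCommClass ℝ 𝒜 𝒜]` of an associative real algebra
(commutativity and a unit are not required). -/

/-- A Riesz space is Archimedean if `n x ≤ y` for all `n`, with `x, y` positive, only for `x = 0`.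
(The class `Archimedean` is another, stronger property.) -/
def IsArchimedeanRiesz (E : Type*) [AddCommGroup E] [Lattice E] : Prop :=
  ∀ x y : E, 0 ≤ x → 0 ≤ y → (∀ n : ℕ, n • x ≤ y) → x = 0

/-- An `f`-algebra: products of positive elements are positive, and multiplication by a positive
element preserves disjointness. -/
structure IsFAlgebra (𝒜 : Type*) [NonUnitalRing 𝒜] [Lattice 𝒜] : Prop where
  mul_nonneg : ∀ x y : 𝒜, 0 ≤ x → 0 ≤ y → 0 ≤ x * y
  mul_inf_eq_zero : ∀ x y z : 𝒜, x ⊓ y = 0 → 0 ≤ z → (x * z) ⊓ y = 0 ∧ (z * x) ⊓ y = 0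

/-- The product `v 0 * v 1 * ⋯ * v n`, in this order. -/
def orderedProduct {𝒜 : Type*} [Mul 𝒜] : (n : ℕ) → (Fin (n + 1) → 𝒜) → 𝒜
  | 0, v => v 0
  | n + 1, v => orderedProduct n (fun i => v i.castSucc) * v (Fin.last (n + 1))

section Multiplicative

variable {n : ℕ} {E : Fin (n + 1) → Type*}
  [∀ i, AddCommGroup (E i)] [∀ i, Lattice (E i)] [∀ i, Module ℝ (E i)]
  {𝒜 : Type*} [NonUnitalRing 𝒜] [Lattice 𝒜] [IsOrderedAddMonoid 𝒜] [Module ℝ 𝒜]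
  [IsOrderedModule ℝ 𝒜]

/-- A regular operator is multiplicative if it is of the form
`(x_1, …, x_m) ↦ T_1 x_1 * ⋯ * T_m x_m` with regular linear operators `T_i`. -/
def IsMultiplicative (A : RegularMultilinear E 𝒜) : Prop :=
  ∃ T : ∀ i, E i →ₗ[ℝ] 𝒜, (∀ i, IsRegularLinear (T i)) ∧
    ∀ x : ∀ i, E i, A.1 x = orderedProduct n fun i => T i (x i)

/-- Finite sums of multiplicative operators. -/
def IsFiniteSumOfMultiplicative (A : RegularMultilinear E 𝒜) : Prop :=
  ∃ (N : ℕ) (B : Fin N → RegularMultilinear E 𝒜), (∀ k, IsMultiplicative (B k)) ∧ A = ∑ k, B k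

end Multiplicative

set_option linter.unusedSectionVars false

/-! ## Layers and disjointness in Riesz spaces -/

section Layers

variable {E : Type*} [AddCommGroup E] [Lattice E] [IsOrderedAddMonoid E]

theorem le_of_le_add_of_inf_eq_zero {a b s : E} (hb : 0 ≤ b) (h : a ≤ b + s) (has : a ⊓ s = 0) :
    a ≤ b := by
  have : a - b ≤ a ⊓ s := le_inf (sub_le_self a hb) (sub_le_iff_le_add'.2 h)
  rw [has] at this
  exact sub_nonpos.1 this

theorem inf_eq_zero_of_le {a b c d : E} (ha : 0 ≤ a) (hb : 0 ≤ b) (hac : a ≤ c) (hbd : b ≤ d)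
    (h : c ⊓ d = 0) : a ⊓ b = 0 :=
  le_antisymm (h ▸ inf_le_inf hac hbd) (le_inf ha hb)

theorem posPart_inf_posPart_sub (a b : E) : (a - b)⁺ ⊓ (b - a)⁺ = 0 := by
  have := posPart_inf_negPart_eq_zero (a - b)
  rwa [← posPart_neg, neg_sub] at this

theorem sub_inf_eq_posPart (a b : E) : a - a ⊓ b = (a - b)⁺ := by
  rw [sub_inf, sub_self, posPart_def, sup_comm]

theorem posPart_inf_eq_sub {z u : E} (hu : 0 ≤ u) : z⁺ ⊓ u = z⁺ - (z - u)⁺ := by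
  have h : (z⁺ - u)⁺ = (z - u)⁺ := by
    simp only [posPart_def]
    rw [sup_sub, sup_assoc, zero_sub, sup_eq_right.2 (neg_nonpos.2 hu)]
  rw [← h, ← sub_inf_eq_posPart, sub_sub_cancel]

variable [Module ℝ E]

/-- The `k`-th layer of thickness `u` of the vector `n • x`. -/
def layer (n : ℕ) (x u : E) (k : ℕ) : E := ((n : ℝ) • x - (k : ℝ) • u)⁺ ⊓ u

theorem layer_nonneg (n : ℕ) (x : E) {u : E} (hu : 0 ≤ u) (k : ℕ) : 0 ≤ layer n x u k :=
  le_inf (posPart_nonneg _) hu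

theorem layer_le (n : ℕ) (x u : E) (k : ℕ) : layer n x u k ≤ u := inf_le_right

theorem layer_succ_inf (n : ℕ) (x : E) {u : E} (hu : 0 ≤ u) (k : ℕ) :
    layer n x u (k + 1) ⊓ (u - layer n x u k) = 0 := by
  set z : E := (n : ℝ) • x - (k : ℝ) • u with hz
  have h1 : layer n x u (k + 1) ≤ (z - u)⁺ := by
    have : (n : ℝ) • x - ((k + 1 : ℕ) : ℝ) • u = z - u := by
      rw [hz]; push_cast; rw [add_smul, one_smul, sub_sub]
    rw [layer, this]
    exact inf_le_left
  have h2 : u - layer n x u k ≤ (u - z)⁺ := by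
    rw [layer, inf_comm, sub_inf_eq_posPart]
    exact posPart_mono (sub_le_sub_left (le_posPart _) u)
  exact inf_eq_zero_of_le (layer_nonneg _ _ hu _) (sub_nonneg.2 (layer_le _ _ _ _)) h1 h2
    (posPart_inf_posPart_sub z u)

variable [IsOrderedModule ℝ E]

theorem sum_layer (n : ℕ) {x u : E} (hx : 0 ≤ x) (hxu : x ≤ u) :
    ∑ k ∈ Finset.range n, layer n x u k = (n : ℝ) • x := by
  have h : ∀ k, layer n x u k = ((n : ℝ) • x - (k : ℝ) • u)⁺ -
      ((n : ℝ) • x - ((k + 1 : ℕ) : ℝ) • u)⁺ := fun k => by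
    rw [layer, posPart_inf_eq_sub (hx.trans hxu)]
    push_cast
    rw [add_smul, one_smul, sub_sub]
  simp only [h]
  rw [Finset.sum_range_sub' (fun k : ℕ => ((n : ℝ) • x - (k : ℝ) • u)⁺), ← smul_sub,
    posPart_eq_zero.2 (smul_nonpos_of_nonneg_of_nonpos (Nat.cast_nonneg n) (sub_nonpos.2 hxu))]
  simp [posPart_of_nonneg, smul_nonneg (Nat.cast_nonneg (α := ℝ) n) hx]

theorem layer_le_smul (n : ℕ) {x u : E} (hx : 0 ≤ x) (hu : 0 ≤ u) (k : ℕ) :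
    layer n x u k ≤ (n : ℝ) • x := by
  refine inf_le_left.trans (sup_le (sub_le_self _ ?_) ?_)
  · exact smul_nonneg (Nat.cast_nonneg k) hu
  · exact smul_nonneg (Nat.cast_nonneg n) hx

theorem smul_inf_eq_zero {x y : E} (h : x ⊓ y = 0) {t : ℝ} (ht : 0 ≤ t) : (t • x) ⊓ y = 0 := by
  have hx : 0 ≤ x := h ▸ inf_le_left
  have hy : 0 ≤ y := h ▸ inf_le_right
  have ht1 : 0 < t + 1 := by linarith
  refine le_antisymm ?_ (le_inf (smul_nonneg ht hx) hy)
  set w := (t • x) ⊓ y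
  have hw : 0 ≤ w := le_inf (smul_nonneg ht hx) hy
  have h1 : (t + 1)⁻¹ • w ≤ x := by
    rw [inv_smul_le_iff_of_pos ht1, add_smul, one_smul]
    exact inf_le_left.trans (le_add_of_nonneg_right hx)
  have h2 : (t + 1)⁻¹ • w ≤ y := by
    rw [inv_smul_le_iff_of_pos ht1, add_smul, one_smul]
    exact inf_le_right.trans (le_add_of_nonneg_left (smul_nonneg ht hy))
  have h3 := le_inf h1 h2
  rw [h, inv_smul_le_iff_of_pos ht1, smul_zero] at h3
  exact h3

theorem IsArchimedeanRiesz.nonpos {E : Type*} [AddCommGroup E] [Lattice E] [IsOrderedAddMonoid E]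
    [Module ℝ E] [IsOrderedModule ℝ E] (hE : IsArchimedeanRiesz E) {x y : E} (hy : 0 ≤ y)
    (h : ∀ n : ℕ, ((n + 1 : ℕ) : ℝ) • x ≤ y) : x ≤ 0 := by
  rw [← posPart_eq_zero]
  refine hE x⁺ y (posPart_nonneg x) hy fun n => ?_
  have h1 : (n + 1) • x⁺ ≤ y := by
    rw [← Nat.cast_smul_eq_nsmul ℝ]
    have hn : (0 : ℝ) < ((n + 1 : ℕ) : ℝ) := by positivity
    rw [← le_inv_smul_iff_of_pos hn]
    exact sup_le ((le_inv_smul_iff_of_pos hn).2 (h n)) (smul_nonneg (inv_nonneg.2 hn.le) hy)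
  exact (nsmul_le_nsmul_left (posPart_nonneg x) n.le_succ).trans h1

/-- A positive bilinear form that vanishes at disjoint vectors is symmetric. -/
theorem orthosymmetric_symm (B : E →ₗ[ℝ] E →ₗ[ℝ] ℝ) (hB : ∀ x y, 0 ≤ x → 0 ≤ y → 0 ≤ B x y)
    (hd : ∀ x y, x ⊓ y = 0 → B x y = 0) (x y : E) : B x y = B y x := by
  have key : ∀ C : E →ₗ[ℝ] E →ₗ[ℝ] ℝ, (∀ x y, 0 ≤ x → 0 ≤ y → 0 ≤ C x y) →
      (∀ x y, x ⊓ y = 0 → C x y = 0) → ∀ x u, 0 ≤ x → x ≤ u → C x u ≤ C u x := by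
    intro C hC hd x u hx hxu
    have hu := hx.trans hxu
    have main : ∀ N : ℕ, ((N + 1 : ℕ) : ℝ) * (C x u - C u x) ≤ C u u := by
      intro N
      have e1 : ((N + 1 : ℕ) : ℝ) * C x u =
          ∑ k ∈ Finset.range (N + 1), C (layer (N + 1) x u k) u := by
        have := congrArg (fun z => C z u) (sum_layer (N + 1) hx hxu)
        simpa [map_sum] using this.symm
      have e2 : ((N + 1 : ℕ) : ℝ) * C u x =
          ∑ k ∈ Finset.range (N + 1), C u (layer (N + 1) x u k) := by
        have := congrArg (fun z => C u z) (sum_layer (N + 1) hx hxu)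
        simpa [map_sum] using this.symm
      have h0 := fun k => layer_nonneg (N + 1) x hu k
      have h1 := fun k => layer_le (N + 1) x u k
      have hstep : ∀ k, C (layer (N + 1) x u (k + 1)) u ≤ C u (layer (N + 1) x u k) := by
        intro k
        have ha := hd _ _ (layer_succ_inf (N + 1) x hu k)
        rw [map_sub, sub_eq_zero] at ha
        have hb := hC _ _ (sub_nonneg.2 (h1 (k + 1))) (h0 k)
        rw [map_sub, LinearMap.sub_apply] at hb
        linarith
      have hlast : 0 ≤ C u (layer (N + 1) x u N) := hC _ _ hu (h0 N)
      have hfirst : C (layer (N + 1) x u 0) u ≤ C u u := by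
        have := hC _ _ (sub_nonneg.2 (h1 0)) hu
        rw [map_sub, LinearMap.sub_apply] at this
        linarith
      rw [mul_sub, e1, e2, Finset.sum_range_succ', Finset.sum_range_succ]
      have := Finset.sum_le_sum fun k (_ : k ∈ Finset.range N) => hstep k
      linarith
    by_contra! hlt
    obtain ⟨N, hN⟩ := exists_nat_gt (C u u / (C x u - C u x))
    have hpos : 0 < C x u - C u x := sub_pos.2 hlt
    rw [div_lt_iff₀ hpos] at hN
    have := main N
    push_cast at this
    nlinarith
  have hpos : ∀ x y, 0 ≤ x → 0 ≤ y → B x y = B y x := by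
    intro x y hx hy
    have hxy : x ≤ x + y := le_add_of_nonneg_right hy
    have h1 := key B hB hd x (x + y) hx hxy
    have h2 := key B.flip (fun a b ha hb => hB b a hb ha)
      (fun a b hab => hd b a (inf_comm a b ▸ hab)) x (x + y) hx hxy
    simp only [LinearMap.flip_apply, map_add, LinearMap.add_apply] at h1 h2
    linarith
  rw [← posPart_sub_negPart x, ← posPart_sub_negPart y]
  simp only [map_sub, LinearMap.sub_apply]
  rw [hpos _ _ (posPart_nonneg x) (posPart_nonneg y), hpos _ _ (posPart_nonneg x)
    (negPart_nonneg y), hpos _ _ (negPart_nonneg x) (posPart_nonneg y),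
    hpos _ _ (negPart_nonneg x) (negPart_nonneg y)]
  ring

end Layers

/-! ## Positive orthomorphisms -/

/-- A positive linear operator with `π x ⊥ y` for all `x ⊥ y`. -/
structure IsPositiveOrthomorphism {E : Type*} [AddCommGroup E] [Lattice E] [Module ℝ E]
    (π : E →ₗ[ℝ] E) : Prop where
  nonneg : ∀ x, 0 ≤ x → 0 ≤ π x
  inf_eq_zero : ∀ x y, x ⊓ y = 0 → π x ⊓ y = 0

namespace IsPositiveOrthomorphism

variable {E : Type*} [AddCommGroup E] [Lattice E] [IsOrderedAddMonoid E] [Module ℝ E]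
  [IsOrderedModule ℝ E] {π τ : E →ₗ[ℝ] E}

theorem mono (hπ : IsPositiveOrthomorphism π) {x y : E} (h : x ≤ y) : π x ≤ π y := by
  have := hπ.nonneg _ (sub_nonneg.2 h)
  rwa [map_sub, sub_nonneg] at this

theorem inf_map_eq_zero (hπ : IsPositiveOrthomorphism π) {x y : E} (h : x ⊓ y = 0) :
    x ⊓ π y = 0 := by
  rw [inf_comm] at h ⊢
  exact hπ.inf_eq_zero _ _ h

theorem smul_id {t : ℝ} (ht : 0 ≤ t) : IsPositiveOrthomorphism (t • LinearMap.id : E →ₗ[ℝ] E) :=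
  ⟨fun _ hx => smul_nonneg ht hx, fun _ _ h => smul_inf_eq_zero h ht⟩

theorem le_of_le_add (hE : IsArchimedeanRiesz E) (hπ : IsPositiveOrthomorphism π)
    (hτ : IsPositiveOrthomorphism τ) {c d s : E} (hd : 0 ≤ d) (hdc : d ≤ c) (hds : d ⊓ s = 0)
    (h : π c ≤ τ c + s) : π d ≤ τ d := by
  have hc := hd.trans hdc
  have hs : 0 ≤ s := hds ▸ inf_le_right
  rw [← sub_nonpos]
  refine hE.nonpos (hτ.nonneg c hc) fun N => ?_
  have h0 := fun k => layer_nonneg (N + 1) d hc k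
  have h1 := fun k => layer_le (N + 1) d c k
  have hle : ∀ k, π (layer (N + 1) d c k) ≤ τ c := fun k => by
    refine le_of_le_add_of_inf_eq_zero (hτ.nonneg c hc) ((hπ.mono (h1 k)).trans h)
      (hπ.inf_eq_zero _ _ ?_)
    exact inf_eq_zero_of_le (h0 k) hs (layer_le_smul _ hd hc k) le_rfl
      (smul_inf_eq_zero hds (Nat.cast_nonneg _))
  have hstep : ∀ k, π (layer (N + 1) d c (k + 1)) ≤ τ (layer (N + 1) d c k) := fun k => by
    refine le_of_le_add_of_inf_eq_zero (s := τ (c - layer (N + 1) d c k)) (hτ.nonneg _ (h0 k)) ?_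
      (hπ.inf_eq_zero _ _ (hτ.inf_map_eq_zero (layer_succ_inf (N + 1) d hc k)))
    rw [← map_add, add_sub_cancel]
    exact hle _
  have hsum := sum_layer (N + 1) hd hdc
  have e1 : ((N + 1 : ℕ) : ℝ) • π d ≤ τ c + ((N + 1 : ℕ) : ℝ) • τ d := by
    rw [← map_smul, ← map_smul, ← hsum, map_sum, map_sum, Finset.sum_range_succ',
      Finset.sum_range_succ, add_comm (Finset.sum _ _)]
    exact add_le_add (hle 0) ((Finset.sum_le_sum fun k _ => hstep k).trans
      (le_add_of_nonneg_right (hτ.nonneg _ (h0 N))))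
  rw [smul_sub, sub_le_iff_le_add]
  exact e1

/-- The inequality `π ≤ t + t⁻¹ π²`. -/
theorem map_le_smul_add (hE : IsArchimedeanRiesz E) (hπ : IsPositiveOrthomorphism π) {t : ℝ}
    (ht : 0 < t) {c : E} (hc : 0 ≤ c) : π c ≤ t • c + t⁻¹ • π (π c) := by
  rw [← sub_nonpos]
  refine hE.nonpos hc fun N => ?_
  set m : ℝ := ((N + 1 : ℕ) : ℝ) with hm
  have hm0 : 0 < m := by positivity
  have hm1 : m⁻¹ ≤ 1 := inv_le_one_of_one_le₀ (by
    rw [hm]; push_cast; linarith [N.cast_nonneg (α := ℝ)])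
  set p : E := (π c - t • c)⁺ with hp
  have hp0 : 0 ≤ p := posPart_nonneg _
  have hmp0 : 0 ≤ m • p := smul_nonneg hm0.le hp0
  have hd0 : 0 ≤ c ⊓ m • p := le_inf hc hmp0
  have hd : t • (c ⊓ m • p) ≤ π (c ⊓ m • p) := by
    refine (smul_id ht.le).le_of_le_add hE hπ (s := (t • c - π c)⁺) hd0 inf_le_left ?_ ?_
    · exact inf_eq_zero_of_le hd0 (posPart_nonneg _) inf_le_right le_rfl
        (smul_inf_eq_zero (posPart_inf_posPart_sub _ _) hm0.le)
    · exact sub_le_iff_le_add'.1 (le_posPart _)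
  have hd' : π (c ⊓ m • p) ≤ t⁻¹ • π (π c) := by
    rw [le_inv_smul_iff_of_pos ht, ← map_smul]
    exact (hπ.mono hd).trans (hπ.mono (hπ.mono inf_le_left))
  have he0 : 0 ≤ (c - m • p)⁺ := posPart_nonneg _
  have hec : (c - m • p)⁺ ≤ c := sup_le (sub_le_self _ hmp0) hc
  have he : π (c - m • p)⁺ ≤ (t + m⁻¹) • (c - m • p)⁺ := by
    refine hπ.le_of_le_add hE (smul_id (by positivity)) (s := (m • p - c)⁺) he0 hec
      (posPart_inf_posPart_sub _ _) ?_
    have h1 : p ≤ m⁻¹ • c + (m • p - c)⁺ := by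
      calc p = m⁻¹ • (c + (m • p - c)) := by
            rw [add_sub_cancel, smul_smul, inv_mul_cancel₀ hm0.ne', one_smul]
        _ ≤ m⁻¹ • c + m⁻¹ • (m • p - c)⁺ := by
            rw [smul_add]
            exact add_le_add le_rfl (smul_le_smul_of_nonneg_left (le_posPart _) (inv_nonneg.2 hm0.le))
        _ ≤ m⁻¹ • c + (m • p - c)⁺ := by
            refine add_le_add le_rfl ?_
            have := smul_le_smul_of_nonneg_right hm1 (posPart_nonneg (m • p - c))
            rwa [one_smul] at this
    have h2 : π c ≤ t • c + p := sub_le_iff_le_add'.1 (le_posPart _)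
    change π c ≤ (t + m⁻¹) • c + _
    rw [add_smul, add_assoc]
    exact h2.trans (add_le_add le_rfl h1)
  have hsplit : c = c ⊓ m • p + (c - m • p)⁺ := by rw [← sub_inf_eq_posPart, add_sub_cancel]
  have h3 : π c ≤ t⁻¹ • π (π c) + (t + m⁻¹) • c := by
    calc π c = π (c ⊓ m • p) + π (c - m • p)⁺ := by rw [← map_add, ← hsplit]
      _ ≤ _ := add_le_add hd' (he.trans (smul_le_smul_of_nonneg_left hec (by positivity)))
  have h4 : π c - (t • c + t⁻¹ • π (π c)) ≤ m⁻¹ • c := by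
    rw [sub_le_iff_le_add]
    refine h3.trans (le_of_eq ?_)
    rw [add_smul]
    abel
  rwa [le_inv_smul_iff_of_pos hm0] at h4

end IsPositiveOrthomorphism

/-! ## Positive functionals, disjointness and series in the order dual -/

namespace RieszDual

variable {E F : Type*} [AddCommGroup E] [Lattice E] [IsOrderedAddMonoid E] [Module ℝ E]
  [AddCommGroup F] [Lattice F] [IsOrderedAddMonoid F] [Module ℝ F]

/-- The adjoint of a regular linear operator. -/
noncomputable def dualMap (T : E →ₗ[ℝ] F) (hT : IsRegularLinear T) :
    RieszDual F →ₗ[ℝ] RieszDual E where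
  toFun f := mk ((f : F →ₗ[ℝ] ℝ) ∘ₗ T) (by
    obtain ⟨P, Q, hP, hQ, rfl⟩ := hT
    have key : ∀ R : E →ₗ[ℝ] F, (∀ x, 0 ≤ x → 0 ≤ R x) →
        (f : F →ₗ[ℝ] ℝ) ∘ₗ R ∈ orderBoundedFunctionals E := by
      intro R hR a b
      have hmono : ∀ x y, x ≤ y → R x ≤ R y := fun x y h => by
        have := hR _ (sub_nonneg.2 h)
        rwa [map_sub, sub_nonneg] at this
      obtain ⟨M, hM⟩ := f.bounded (R a) (R b)
      exact ⟨M, fun x hx => hM _ ⟨hmono _ _ hx.1, hmono _ _ hx.2⟩⟩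
    rw [LinearMap.comp_sub]
    exact (orderBoundedFunctionals E).sub_mem (key P hP) (key Q hQ))
  map_add' _ _ := rfl
  map_smul' _ _ := rfl

@[simp] theorem dualMap_apply (T : E →ₗ[ℝ] F) (hT : IsRegularLinear T) (f : RieszDual F) (x : E) :
    dualMap T hT f x = f (T x) := rfl

theorem dualMap_isRegular [IsOrderedModule ℝ E] [IsOrderedModule ℝ F] (T : E →ₗ[ℝ] F)
    (hT : IsRegularLinear T) : IsRegularLinear (dualMap T hT) := by
  have hT' := hT
  obtain ⟨P, Q, hP, hQ, e⟩ := hT'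
  refine ⟨dualMap P ⟨P, 0, hP, fun _ _ => le_rfl, (sub_zero P).symm⟩,
    dualMap Q ⟨Q, 0, hQ, fun _ _ => le_rfl, (sub_zero Q).symm⟩,
    fun f hf x hx => hf _ (hP x hx), fun f hf x hx => hf _ (hQ x hx), ?_⟩
  ext f x
  change f (T x) = f (P x) - f (Q x)
  rw [e, ← map_sub]
  rfl

/-- A positive linear functional is order bounded. -/
def ofNonneg (f : E →ₗ[ℝ] ℝ) (hf : ∀ x, 0 ≤ x → 0 ≤ f x) : RieszDual E :=
  mk f (by
    have hmono : ∀ x y, x ≤ y → f x ≤ f y := fun x y h => by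
      have := hf _ (sub_nonneg.2 h)
      rwa [map_sub, sub_nonneg] at this
    refine fun a b => ⟨max |f a| |f b|, fun x hx => abs_le_max_abs_abs (hmono _ _ hx.1)
      (hmono _ _ hx.2)⟩)

variable [IsOrderedModule ℝ E]

theorem isArchimedeanRiesz : IsArchimedeanRiesz (RieszDual E) := by
  intro f g hf hg h
  refine le_antisymm (fun x hx => ?_) hf
  by_contra! hlt
  obtain ⟨n, hn⟩ := exists_nat_gt (g x / f x)
  rw [zero_apply] at hlt
  rw [div_lt_iff₀ hlt] at hn
  have h1 := h n x hx
  rw [← Nat.cast_smul_eq_nsmul ℝ, smul_apply] at h1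
  linarith

theorem exists_add_lt {f g : RieszDual E} (h : f ⊓ g = 0) {x : E} (hx : 0 ≤ x) {ε : ℝ}
    (hε : 0 < ε) : ∃ y z : E, 0 ≤ y ∧ 0 ≤ z ∧ y + z = x ∧ f y + g z < ε := by
  have h1 : (f ⊓ g) x = f x - sSup ((f - g) '' Icc 0 x) := by
    change (f - pos (f - g)) x = _
    rw [sub_apply, pos_apply _ hx]
    rfl
  rw [h, zero_apply] at h1
  obtain ⟨_, ⟨y, hy, rfl⟩, hlt⟩ := exists_lt_of_lt_csSup (s := (f - g) '' Icc 0 x)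
    ⟨_, ⟨0, ⟨le_rfl, hx⟩, rfl⟩⟩ (b := f x - ε) (by linarith)
  refine ⟨x - y, y, sub_nonneg.2 hy.2, hy.1, sub_add_cancel _ _, ?_⟩
  rw [sub_apply] at hlt
  rw [map_sub]
  linarith

theorem inf_eq_zero_of_forall {f g : RieszDual E} (hf : 0 ≤ f) (hg : 0 ≤ g)
    (h : ∀ x : E, 0 ≤ x → ∀ ε : ℝ, 0 < ε →
      ∃ y z : E, 0 ≤ y ∧ 0 ≤ z ∧ y + z = x ∧ f y + g z ≤ ε) : f ⊓ g = 0 := by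
  refine le_antisymm (fun x hx => ?_) (le_inf hf hg)
  refine le_of_forall_pos_le_add fun ε hε => ?_
  obtain ⟨y, z, hy, hz, rfl, hyz⟩ := h x hx ε hε
  have h1 : (f ⊓ g) y ≤ f y := (inf_le_left : f ⊓ g ≤ f) y hy
  have h2 : (f ⊓ g) z ≤ g z := (inf_le_right : f ⊓ g ≤ g) z hz
  rw [map_add, zero_apply]
  linarith

theorem dualMap_isPositiveOrthomorphism (hE : IsArchimedeanRiesz E) {π : E →ₗ[ℝ] E}
    (hπ : IsPositiveOrthomorphism π) (hr : IsRegularLinear π) :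
    IsPositiveOrthomorphism (dualMap π hr) := by
  have hnn : ∀ f : RieszDual E, 0 ≤ f → 0 ≤ dualMap π hr f := fun f hf x hx =>
    hf _ (hπ.nonneg x hx)
  refine ⟨hnn, fun f g h => ?_⟩
  have hf : 0 ≤ f := h ▸ inf_le_left
  have hg : 0 ≤ g := h ▸ inf_le_right
  refine inf_eq_zero_of_forall (hnn f hf) hg fun x hx ε hε => ?_
  have hC : 0 ≤ f (π (π x)) := hf _ (hπ.nonneg _ (hπ.nonneg _ hx))
  obtain ⟨t, ht, htC⟩ : ∃ t : ℝ, 0 < t ∧ t⁻¹ * f (π (π x)) ≤ ε / 2 := by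
    refine ⟨(f (π (π x)) + 1) / (ε / 2), by positivity, ?_⟩
    rw [inv_div, div_mul_eq_mul_div, div_le_iff₀ (by positivity)]
    nlinarith
  obtain ⟨y, z, hy, hz, rfl, hyz⟩ := exists_add_lt h hx (ε := ε / 2 / (t + 1)) (by positivity)
  refine ⟨y, z, hy, hz, rfl, ?_⟩
  rw [lt_div_iff₀ (by positivity)] at hyz
  have h1 := mono hf (hπ.map_le_smul_add hE ht hy)
  have h2 : f (π (π y)) ≤ f (π (π (y + z))) :=
    mono hf (hπ.mono (hπ.mono (le_add_of_nonneg_right hz)))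
  have h3 := mul_le_mul_of_nonneg_left h2 (inv_nonneg.2 ht.le)
  simp only [map_add, map_smul, smul_eq_mul] at h1 h3 htC
  rw [dualMap_apply]
  have := nonneg_apply hf hy
  have := nonneg_apply hg hz
  nlinarith

theorem sum_apply {ι : Type*} (s : Finset ι) (f : ι → RieszDual E) (x : E) :
    (∑ i ∈ s, f i) x = ∑ i ∈ s, f i x := by
  classical
  induction s using Finset.induction_on with
  | empty => simp
  | insert a s ha ih => rw [Finset.sum_insert ha, Finset.sum_insert ha, add_apply, ih]

/-- If a series of positive functionals converges pointwise, then every positive element of the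
second order dual tends to zero along it. -/
theorem tendsto_zero_of_summable {h : ℕ → RieszDual E} (h0 : ∀ n, 0 ≤ h n)
    (hs : ∀ x : E, 0 ≤ x → Summable fun n => h n x) {G : RieszDual (RieszDual E)} (hG : 0 ≤ G) :
    Filter.Tendsto (fun n => G (h n)) Filter.atTop (nhds 0) := by
  have hs' : ∀ x : E, Summable fun n => h n x := fun x => by
    have := (hs _ (posPart_nonneg x)).sub (hs _ (negPart_nonneg x))
    simpa only [← map_sub, posPart_sub_negPart] using this
  let g : RieszDual E := ofNonneg
    { toFun := fun x => ∑' n, h n x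
      map_add' := fun x y => by
        simp only [map_add]
        exact (hs' x).tsum_add (hs' y)
      map_smul' := fun c x => by
        simp only [map_smul, smul_eq_mul, RingHom.id_apply]
        exact tsum_mul_left }
    fun x hx => tsum_nonneg fun n => h0 n x hx
  have hle : ∀ N, ∑ n ∈ Finset.range N, h n ≤ g := fun N x hx => by
    rw [sum_apply]
    exact (hs' x).sum_le_tsum _ fun n _ => h0 n x hx
  refine (summable_of_sum_range_le (c := G g) (fun n => hG _ (h0 n)) fun N => ?_).tendsto_atTop_zero
  rw [← map_sum]
  exact mono hG (hle N)

end RieszDual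

theorem summable_of_le_pow {a : ℕ → ℝ} {C : ℝ} (h0 : ∀ n, 0 ≤ a n)
    (h : ∀ n, a n ≤ C * (1 / 2) ^ n) : Summable a :=
  Summable.of_nonneg_of_le h0 h (summable_geometric_two.mul_left C)

theorem IsPositiveOrthomorphism.apply_map_le {E : Type*} [AddCommGroup E] [Lattice E]
    [IsOrderedAddMonoid E] [Module ℝ E] [IsOrderedModule ℝ E] (hE : IsArchimedeanRiesz E)
    {π : E →ₗ[ℝ] E} (hπ : IsPositiveOrthomorphism π) {f : RieszDual E} (hf : 0 ≤ f) {x y : E}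
    (hy : 0 ≤ y) (hyx : y ≤ x) {n : ℕ} (h : f y ≤ (1 / 4) ^ n) :
    f (π y) ≤ (1 + f (π (π x))) * (1 / 2) ^ n := by
  have h1 := RieszDual.mono hf (hπ.map_le_smul_add hE (t := 2 ^ n) (by positivity) hy)
  have h2 : f (π (π y)) ≤ f (π (π x)) := RieszDual.mono hf (hπ.mono (hπ.mono hyx))
  simp only [map_add, map_smul, smul_eq_mul] at h1
  have h3 : (2 : ℝ) ^ n * (1 / 4) ^ n = (1 / 2) ^ n := by rw [← mul_pow]; norm_num
  have h4 : ((2 : ℝ) ^ n)⁻¹ = (1 / 2) ^ n := by rw [one_div, inv_pow]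
  have h5 : (2 : ℝ) ^ n * f y ≤ 2 ^ n * (1 / 4) ^ n := mul_le_mul_of_nonneg_left h (by positivity)
  have h6 : (1 / 2 : ℝ) ^ n * f (π (π y)) ≤ (1 / 2) ^ n * f (π (π x)) :=
    mul_le_mul_of_nonneg_left h2 (by positivity)
  rw [h4] at h1
  rw [h3] at h5
  linarith

/-! ## Arens multiplication on the second order dual of an Archimedean `f`-algebra -/

namespace IsFAlgebra

variable {𝒜 : Type*} [NonUnitalRing 𝒜] [Lattice 𝒜] [IsOrderedAddMonoid 𝒜]
  [Module ℝ 𝒜] [IsOrderedModule ℝ 𝒜] [IsScalarTower ℝ 𝒜 𝒜] [SMulCommClass ℝ 𝒜 𝒜]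

theorem mul_eq_zero_of_inf (hf : IsFAlgebra 𝒜) {x y : 𝒜} (h : x ⊓ y = 0) : x * y = 0 := by
  have hx : 0 ≤ x := h ▸ inf_le_left
  have hy : 0 ≤ y := h ▸ inf_le_right
  have h1 := (hf.mul_inf_eq_zero x y y h hy).1
  rw [inf_comm] at h1
  simpa using (hf.mul_inf_eq_zero y (x * y) x h1 hx).2

theorem mulLeft_isPositiveOrthomorphism (hf : IsFAlgebra 𝒜) {a : 𝒜} (ha : 0 ≤ a) :
    IsPositiveOrthomorphism (LinearMap.mulLeft ℝ a) :=
  ⟨fun x hx => hf.mul_nonneg a x ha hx, fun x y h => (hf.mul_inf_eq_zero x y a h ha).2⟩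

theorem mulRight_isPositiveOrthomorphism (hf : IsFAlgebra 𝒜) {a : 𝒜} (ha : 0 ≤ a) :
    IsPositiveOrthomorphism (LinearMap.mulRight ℝ a) :=
  ⟨fun x hx => hf.mul_nonneg x a hx ha, fun x y h => (hf.mul_inf_eq_zero x y a h ha).1⟩

theorem isRegularLinear_mulRight (hf : IsFAlgebra 𝒜) (a : 𝒜) :
    IsRegularLinear (LinearMap.mulRight ℝ a) := by
  refine ⟨LinearMap.mulRight ℝ a⁺, LinearMap.mulRight ℝ a⁻,
    (hf.mulRight_isPositiveOrthomorphism (posPart_nonneg a)).nonneg,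
    (hf.mulRight_isPositiveOrthomorphism (negPart_nonneg a)).nonneg, ?_⟩
  ext x
  change x * a = x * a⁺ - x * a⁻
  rw [← mul_sub, posPart_sub_negPart]

/-- An order bounded functional on an `f`-algebra does not see the order of the factors. -/
theorem apply_mul_comm (hf : IsFAlgebra 𝒜) (h : RieszDual 𝒜) (a b : 𝒜) :
    h (a * b) = h (b * a) := by
  have key : ∀ g : RieszDual 𝒜, 0 ≤ g → g (a * b) = g (b * a) := fun g hg =>
    orthosymmetric_symm ((LinearMap.mul ℝ 𝒜).compr₂ (g : 𝒜 →ₗ[ℝ] ℝ))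
      (fun x y hx hy => hg _ (hf.mul_nonneg x y hx hy))
      (fun x y hxy => by
        change g (x * y) = 0
        rw [hf.mul_eq_zero_of_inf hxy, map_zero]) a b
  rw [← posPart_sub_negPart h, RieszDual.sub_apply, RieszDual.sub_apply,
    key _ (posPart_nonneg h), key _ (negPart_nonneg h)]

theorem apply_mul_mul_comm (hf : IsFAlgebra 𝒜) (h : RieszDual 𝒜) (c a b : 𝒜) :
    h (c * a * b) = h (c * b * a) := by
  have key : ∀ (g : RieszDual 𝒜) (d : 𝒜), 0 ≤ g → 0 ≤ d → g (d * (a * b)) = g (d * (b * a)) :=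
    fun g d hg hd =>
      orthosymmetric_symm ((LinearMap.mul ℝ 𝒜).compr₂
        ((g : 𝒜 →ₗ[ℝ] ℝ) ∘ₗ LinearMap.mulLeft ℝ d))
        (fun x y hx hy => hg _ (hf.mul_nonneg d _ hd (hf.mul_nonneg x y hx hy)))
        (fun x y hxy => by
          change g (d * (x * y)) = 0
          rw [hf.mul_eq_zero_of_inf hxy, mul_zero, map_zero]) a b
  have key' : ∀ g : RieszDual 𝒜, 0 ≤ g → g (c * (a * b)) = g (c * (b * a)) := fun g hg => by
    rw [← posPart_sub_negPart c, sub_mul, sub_mul, map_sub, map_sub,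
      key _ _ hg (posPart_nonneg c), key _ _ hg (negPart_nonneg c)]
  rw [mul_assoc, mul_assoc, ← posPart_sub_negPart h, RieszDual.sub_apply, RieszDual.sub_apply,
    key' _ (posPart_nonneg h), key' _ (negPart_nonneg h)]

/-- The functional `x ↦ h (x * a)`. -/
noncomputable def act (hf : IsFAlgebra 𝒜) (a : 𝒜) : RieszDual 𝒜 →ₗ[ℝ] RieszDual 𝒜 :=
  RieszDual.dualMap (LinearMap.mulRight ℝ a) (hf.isRegularLinear_mulRight a)

@[simp] theorem act_apply (hf : IsFAlgebra 𝒜) (a : 𝒜) (h : RieszDual 𝒜) (x : 𝒜) :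
    hf.act a h x = h (x * a) := rfl

theorem act_add (hf : IsFAlgebra 𝒜) (a b : 𝒜) (h : RieszDual 𝒜) :
    hf.act (a + b) h = hf.act a h + hf.act b h := by
  ext x
  simp [mul_add]

theorem act_smul (hf : IsFAlgebra 𝒜) (c : ℝ) (a : 𝒜) (h : RieszDual 𝒜) :
    hf.act (c • a) h = c • hf.act a h := by
  ext x
  simp [mul_smul_comm]

theorem act_comm (hf : IsFAlgebra 𝒜) (a b : 𝒜) (h : RieszDual 𝒜) :
    hf.act a (hf.act b h) = hf.act b (hf.act a h) := by
  ext x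
  simp only [act_apply]
  rw [hf.apply_mul_mul_comm]

theorem act_nonneg (hf : IsFAlgebra 𝒜) {a : 𝒜} (ha : 0 ≤ a) {h : RieszDual 𝒜} (hh : 0 ≤ h) :
    0 ≤ hf.act a h := fun x hx => hh _ (hf.mul_nonneg x a hx ha)

theorem act_mono (hf : IsFAlgebra 𝒜) {a b : 𝒜} (hab : a ≤ b) {h : RieszDual 𝒜} (hh : 0 ≤ h) :
    hf.act a h ≤ hf.act b h := by
  rw [← sub_nonneg]
  have := hf.act_nonneg (sub_nonneg.2 hab) hh
  rwa [sub_eq_add_neg, act_add, ← neg_one_smul ℝ a, act_smul, neg_one_smul,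
    ← sub_eq_add_neg] at this

theorem abs_act_le (hf : IsFAlgebra 𝒜) (a : 𝒜) (h : RieszDual 𝒜) :
    |hf.act a h| ≤ hf.act |a| |h| := by
  have key : ∀ x : 𝒜, 0 ≤ x → |h (x * a)| ≤ |h| (x * |a|) := fun x hx => by
    refine (h.abs_apply_le _).trans (RieszDual.mono (abs_nonneg h) (abs_le'.2 ⟨?_, ?_⟩))
    · rw [← sub_nonneg, ← mul_sub]
      exact hf.mul_nonneg _ _ hx (sub_nonneg.2 (le_abs_self a))
    · rw [← sub_nonneg, ← mul_neg, ← mul_sub]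
      exact hf.mul_nonneg _ _ hx (sub_nonneg.2 (neg_le_abs a))
  exact abs_le'.2 ⟨fun x hx => (le_abs_self _).trans (key x hx),
    fun x hx => (neg_le_abs _).trans (key x hx)⟩

theorem act_isPositiveOrthomorphism (hA : IsArchimedeanRiesz 𝒜) (hf : IsFAlgebra 𝒜) {a : 𝒜}
    (ha : 0 ≤ a) : IsPositiveOrthomorphism (hf.act a) :=
  RieszDual.dualMap_isPositiveOrthomorphism hA (hf.mulRight_isPositiveOrthomorphism ha) _

/-- The functional `x ↦ G (h (· * x))`. -/
noncomputable def arensAct (hf : IsFAlgebra 𝒜) (G : RieszDual (RieszDual 𝒜)) :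
    RieszDual 𝒜 →ₗ[ℝ] RieszDual 𝒜 where
  toFun h := RieszDual.mk
    { toFun := fun x => G (hf.act x h)
      map_add' := fun x y => by rw [act_add, map_add]
      map_smul' := fun c x => by rw [act_smul, map_smul]; rfl } (by
    intro a b
    refine ⟨|G| (hf.act (|a| + |b|) |h|), fun x hx => ?_⟩
    have hx' : |x| ≤ |a| + |b| := by
      rw [abs_le']
      constructor
      · exact hx.2.trans ((le_abs_self b).trans (le_add_of_nonneg_left (abs_nonneg a)))
      · exact (neg_le_neg hx.1).trans
          ((neg_le_abs a).trans (le_add_of_nonneg_right (abs_nonneg b)))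
    exact (G.abs_apply_le _).trans (RieszDual.mono (abs_nonneg G)
      ((hf.abs_act_le x h).trans (hf.act_mono hx' (abs_nonneg h)))))
  map_add' h k := by
    ext x
    change G (hf.act x (h + k)) = G (hf.act x h) + G (hf.act x k)
    rw [map_add, map_add]
  map_smul' c h := by
    ext x
    change G (hf.act x (c • h)) = c * G (hf.act x h)
    rw [map_smul, map_smul]
    rfl

@[simp] theorem arensAct_apply (hf : IsFAlgebra 𝒜) (G : RieszDual (RieszDual 𝒜))
    (h : RieszDual 𝒜) (x : 𝒜) : hf.arensAct G h x = G (hf.act x h) := rfl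

theorem arensAct_act_comm (hf : IsFAlgebra 𝒜) (G : RieszDual (RieszDual 𝒜)) (a : 𝒜)
    (h : RieszDual 𝒜) : hf.arensAct G (hf.act a h) = hf.act a (hf.arensAct G h) := by
  ext x
  simp only [act_apply, arensAct_apply]
  congr 1
  ext y
  simp only [act_apply, mul_assoc]

theorem arensAct_isPositiveOrthomorphism (hA : IsArchimedeanRiesz 𝒜) (hf : IsFAlgebra 𝒜)
    {G : RieszDual (RieszDual 𝒜)} (hG : 0 ≤ G) : IsPositiveOrthomorphism (hf.arensAct G) := by
  have hnn : ∀ h : RieszDual 𝒜, 0 ≤ h → 0 ≤ hf.arensAct G h := fun h hh x hx =>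
    hG _ (hf.act_nonneg hx hh)
  refine ⟨hnn, fun h k hhk => ?_⟩
  have hh : 0 ≤ h := hhk ▸ inf_le_left
  have hk : 0 ≤ k := hhk ▸ inf_le_right
  refine RieszDual.inf_eq_zero_of_forall (hnn h hh) hk fun x hx ε hε => ?_
  choose y z hy hz hyz hlt using fun n : ℕ =>
    RieszDual.exists_add_lt hhk hx (ε := (1 / 4) ^ n) (by positivity)
  have hyx : ∀ n, y n ≤ x := fun n => by
    rw [← hyz n]; exact le_add_of_nonneg_right (hz n)
  have h1 : ∀ n, h (y n) ≤ (1 / 4) ^ n := fun n => by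
    have := RieszDual.nonneg_apply hk (hz n)
    linarith [hlt n]
  have h2 : ∀ n, k (z n) ≤ (1 / 4) ^ n := fun n => by
    have := RieszDual.nonneg_apply hh (hy n)
    linarith [hlt n]
  have ht := RieszDual.tendsto_zero_of_summable (h := fun n => hf.act (y n) h)
    (fun n => hf.act_nonneg (hy n) hh) (fun c hc => summable_of_le_pow
      (fun n => hh _ (hf.mul_nonneg _ _ hc (hy n)))
      fun n => (hf.mulLeft_isPositiveOrthomorphism hc).apply_map_le hA hh (hy n) (hyx n) (h1 n)) hG
  have ht' := ht.add (tendsto_pow_atTop_nhds_zero_of_lt_one (r := (1 / 4 : ℝ)) (by norm_num)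
    (by norm_num))
  rw [add_zero] at ht'
  obtain ⟨n, hn⟩ := (ht'.eventually_lt_const hε).exists
  exact ⟨y n, z n, hy n, hz n, hyz n, (add_le_add le_rfl (h2 n)).trans hn.le⟩

/-- The Arens product of disjoint elements of the second order dual vanishes. -/
theorem apply_arensAct_eq_zero (hA : IsArchimedeanRiesz 𝒜) (hf : IsFAlgebra 𝒜)
    {F G : RieszDual (RieszDual 𝒜)} (hFG : F ⊓ G = 0) {f : RieszDual 𝒜} (hf0 : 0 ≤ f) :
    F (hf.arensAct G f) = 0 := by
  have hF : 0 ≤ F := hFG ▸ inf_le_left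
  have hG : 0 ≤ G := hFG ▸ inf_le_right
  have hGo := hf.arensAct_isPositiveOrthomorphism hA hG
  choose h k hh hk hhk hlt using fun n : ℕ =>
    RieszDual.exists_add_lt hFG hf0 (ε := (1 / 4) ^ n) (by positivity)
  have h1 : ∀ n, F (h n) ≤ (1 / 4) ^ n := fun n => by
    have := RieszDual.nonneg_apply hG (hk n)
    linarith [hlt n]
  have h2 : ∀ n, G (k n) ≤ (1 / 4) ^ n := fun n => by
    have := RieszDual.nonneg_apply hF (hh n)
    linarith [hlt n]
  have hhf : ∀ n, h n ≤ f := fun n => by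
    rw [← hhk n]; exact le_add_of_nonneg_right (hk n)
  have hkf : ∀ n, k n ≤ f := fun n => by
    rw [← hhk n]; exact le_add_of_nonneg_left (hh n)
  have t1 : Filter.Tendsto (fun n => F (hf.arensAct G (h n))) Filter.atTop (nhds 0) :=
    (summable_of_le_pow (fun n => hF _ (hGo.nonneg _ (hh n)))
      fun n => hGo.apply_map_le RieszDual.isArchimedeanRiesz hF (hh n) (hhf n)
        (h1 n)).tendsto_atTop_zero
  have t2 := RieszDual.tendsto_zero_of_summable (h := fun n => hf.arensAct G (k n))
    (fun n => hGo.nonneg _ (hk n)) (fun c hc => summable_of_le_pow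
      (fun n => hG _ (hf.act_nonneg hc (hk n)))
      fun n => (hf.act_isPositiveOrthomorphism hA hc).apply_map_le RieszDual.isArchimedeanRiesz hG
        (hk n) (hkf n) (h2 n)) hF
  have t3 := t1.add t2
  simp only [← map_add, hhk, add_zero] at t3
  exact tendsto_nhds_unique tendsto_const_nhds t3

/-- The Arens multiplication of an Archimedean `f`-algebra is commutative. -/
theorem apply_arensAct_comm (hA : IsArchimedeanRiesz 𝒜) (hf : IsFAlgebra 𝒜)
    (F G : RieszDual (RieszDual 𝒜)) (f : RieszDual 𝒜) :
    F (hf.arensAct G f) = G (hf.arensAct F f) := by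
  have key : ∀ g : RieszDual 𝒜, 0 ≤ g → F (hf.arensAct G g) = G (hf.arensAct F g) := fun g hg =>
    orthosymmetric_symm (LinearMap.mk₂ ℝ (fun F G : RieszDual (RieszDual 𝒜) =>
        F (hf.arensAct G g)) (fun _ _ _ => rfl) (fun _ _ _ => rfl)
        (fun F H K => map_add F (hf.arensAct H g) (hf.arensAct K g))
        (fun c F H => map_smul F c (hf.arensAct H g)))
      (fun x y hx hy => RieszDual.nonneg_apply hx fun _ ha =>
        RieszDual.nonneg_apply hy (hf.act_nonneg ha hg))
      (fun x y hxy => hf.apply_arensAct_eq_zero hA hxy hg) F G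
  rw [← posPart_sub_negPart f]
  simp only [map_sub]
  rw [key _ (posPart_nonneg f), key _ (negPart_nonneg f)]

theorem arensAct_comm (hA : IsArchimedeanRiesz 𝒜) (hf : IsFAlgebra 𝒜)
    (F G : RieszDual (RieszDual 𝒜)) (f : RieszDual 𝒜) :
    hf.arensAct F (hf.arensAct G f) = hf.arensAct G (hf.arensAct F f) := by
  ext x
  rw [arensAct_apply, arensAct_apply, ← arensAct_act_comm, ← arensAct_act_comm,
    hf.apply_arensAct_comm hA]

end IsFAlgebra

/-! ## Arens extensions of multiplicative operators -/

namespace IsFAlgebra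

variable {𝒜 : Type*} [NonUnitalRing 𝒜] [Lattice 𝒜] [IsOrderedAddMonoid 𝒜]
  [Module ℝ 𝒜] [IsOrderedModule ℝ 𝒜] [IsScalarTower ℝ 𝒜 𝒜] [SMulCommClass ℝ 𝒜 𝒜]

/-- The action on the order dual of elements of the algebra and of its second order dual. -/
noncomputable def letter (hf : IsFAlgebra 𝒜) (c : 𝒜 ⊕ RieszDual (RieszDual 𝒜))
    (h : RieszDual 𝒜) : RieszDual 𝒜 :=
  c.elim (fun a => hf.act a h) fun G => hf.arensAct G h

theorem letter_leftCommutative (hA : IsArchimedeanRiesz 𝒜) (hf : IsFAlgebra 𝒜) :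
    LeftCommutative hf.letter := by
  refine ⟨?_⟩
  rintro (a | F) (b | G) h
  · exact hf.act_comm a b h
  · exact (hf.arensAct_act_comm G a h).symm
  · exact hf.arensAct_act_comm F b h
  · exact hf.arensAct_comm hA F G h

variable {ι : Type*} [DecidableEq ι]

/-- The commuting letters `c i`, for `i ∈ s`, applied to the functional `h`. -/
noncomputable def word (hA : IsArchimedeanRiesz 𝒜) (hf : IsFAlgebra 𝒜) (s : Finset ι)
    (c : ι → 𝒜 ⊕ RieszDual (RieszDual 𝒜)) (h : RieszDual 𝒜) : RieszDual 𝒜 :=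
  haveI := letter_leftCommutative hA hf
  (s.val.map c).foldr hf.letter h

theorem word_empty (hA : IsArchimedeanRiesz 𝒜) (hf : IsFAlgebra 𝒜)
    (c : ι → 𝒜 ⊕ RieszDual (RieszDual 𝒜)) (h : RieszDual 𝒜) : hf.word hA ∅ c h = h := by
  simp [word]

theorem word_eq_letter (hA : IsArchimedeanRiesz 𝒜) (hf : IsFAlgebra 𝒜) {s : Finset ι} {l : ι}
    (hl : l ∈ s) (c : ι → 𝒜 ⊕ RieszDual (RieszDual 𝒜)) (h : RieszDual 𝒜) :
    hf.word hA s c h = hf.letter (c l) (hf.word hA (s.erase l) c h) := by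
  have e : s.val = l ::ₘ (s.erase l).val := by
    rw [Finset.erase_val, Multiset.cons_erase hl]
  simp only [word]
  rw [e, Multiset.map_cons, Multiset.foldr_cons]

theorem word_congr (hA : IsArchimedeanRiesz 𝒜) (hf : IsFAlgebra 𝒜) {s : Finset ι}
    {c d : ι → 𝒜 ⊕ RieszDual (RieszDual 𝒜)} (hcd : ∀ i ∈ s, c i = d i) (h : RieszDual 𝒜) :
    hf.word hA s c h = hf.word hA s d h := by
  simp only [word]
  rw [Multiset.map_congr rfl hcd]

theorem word_letter (hA : IsArchimedeanRiesz 𝒜) (hf : IsFAlgebra 𝒜) (s : Finset ι)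
    (c : ι → 𝒜 ⊕ RieszDual (RieszDual 𝒜)) (b : 𝒜 ⊕ RieszDual (RieszDual 𝒜)) (h : RieszDual 𝒜) :
    hf.word hA s c (hf.letter b h) = hf.letter b (hf.word hA s c h) := by
  induction s using Finset.induction_on with
  | empty => simp only [word_empty]
  | insert i s hi ih =>
    rw [hf.word_eq_letter hA (Finset.mem_insert_self i s),
      hf.word_eq_letter hA (Finset.mem_insert_self i s), Finset.erase_insert hi, ih]
    exact (letter_leftCommutative hA hf).left_comm _ _ _

theorem word_map {κ : Type*} [DecidableEq κ] (hA : IsArchimedeanRiesz 𝒜) (hf : IsFAlgebra 𝒜)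
    (s : Finset κ) (e : κ ↪ ι) (c : ι → 𝒜 ⊕ RieszDual (RieszDual 𝒜)) (h : RieszDual 𝒜) :
    hf.word hA (s.map e) c h = hf.word hA s (c ∘ e) h := by
  simp only [word, Finset.map_val, Multiset.map_map]

theorem word_erase_apply_inl (hA : IsArchimedeanRiesz 𝒜) (hf : IsFAlgebra 𝒜) [Fintype ι]
    (a : ι → 𝒜) (h : RieszDual 𝒜) (j l : ι) :
    hf.word hA (Finset.univ.erase j) (fun i => Sum.inl (a i)) h (a j) =
      hf.word hA (Finset.univ.erase l) (fun i => Sum.inl (a i)) h (a l) := by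
  rcases eq_or_ne j l with rfl | hjl
  · rfl
  rw [hf.word_eq_letter hA (Finset.mem_erase.2 ⟨hjl.symm, Finset.mem_univ l⟩),
    hf.word_eq_letter hA (Finset.mem_erase.2 ⟨hjl, Finset.mem_univ j⟩), Finset.erase_right_comm]
  exact hf.apply_mul_comm _ _ _

theorem apply_word_erase_inr (hA : IsArchimedeanRiesz 𝒜) (hf : IsFAlgebra 𝒜) [Fintype ι]
    (X : ι → RieszDual (RieszDual 𝒜)) (h : RieszDual 𝒜) (j l : ι) :
    X j (hf.word hA (Finset.univ.erase j) (fun i => Sum.inr (X i)) h) =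
      X l (hf.word hA (Finset.univ.erase l) (fun i => Sum.inr (X i)) h) := by
  rcases eq_or_ne j l with rfl | hjl
  · rfl
  rw [hf.word_eq_letter hA (Finset.mem_erase.2 ⟨hjl.symm, Finset.mem_univ l⟩),
    hf.word_eq_letter hA (Finset.mem_erase.2 ⟨hjl, Finset.mem_univ j⟩), Finset.erase_right_comm]
  exact hf.apply_arensAct_comm hA _ _ _

theorem apply_orderedProduct (hA : IsArchimedeanRiesz 𝒜) (hf : IsFAlgebra 𝒜) (n : ℕ)
    (a : Fin (n + 1) → 𝒜) (h : RieszDual 𝒜) (j : Fin (n + 1)) :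
    h (orderedProduct n a) =
      hf.word hA (Finset.univ.erase j) (fun i => Sum.inl (a i)) h (a j) := by
  induction n generalizing h with
  | zero =>
    obtain rfl : j = 0 := Subsingleton.elim (α := Fin 1) _ _
    have : (Finset.univ : Finset (Fin (0 + 1))).erase 0 = ∅ := rfl
    rw [this, word_empty]
    rfl
  | succ n ih =>
    rw [hf.word_erase_apply_inl hA a h j (Fin.castSucc 0)]
    have hmem : Fin.last (n + 1) ∈ (Finset.univ : Finset (Fin (n + 2))).erase (Fin.castSucc 0) :=
      Finset.mem_erase.2 ⟨(Fin.castSucc_lt_last 0).ne', Finset.mem_univ _⟩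
    have e : ((Finset.univ : Finset (Fin (n + 2))).erase (Fin.castSucc 0)).erase
        (Fin.last (n + 1)) = ((Finset.univ : Finset (Fin (n + 1))).erase 0).map
          Fin.castSuccEmb := by
      rw [Finset.erase_right_comm, Fin.univ_castSuccEmb, Finset.erase_cons, Finset.map_erase]
      rfl
    rw [hf.word_eq_letter hA hmem, e, word_map, ← word_letter]
    exact ih (fun i => a i.castSucc) (hf.act (a (Fin.last (n + 1))) h) 0

end IsFAlgebra

namespace Arens

open Classical in
/-- The letters that the variables in `s` and the fixed elements of the second duals provide. -/
noncomputable def letters {ι : Type*} {E : ι → Type*} {𝒜 Z : Type*} (s : Set ι)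
    (T : ∀ i, E i → 𝒜) (X : ι → Z) (x : ∀ i : s, E i) (i : ι) : 𝒜 ⊕ Z :=
  if hi : i ∈ s then Sum.inl (T i (x ⟨i, hi⟩)) else Sum.inr (X i)

theorem letters_of_mem {ι : Type*} {E : ι → Type*} {𝒜 Z : Type*} {s : Set ι}
    (T : ∀ i, E i → 𝒜) (X : ι → Z) (x : ∀ i : s, E i) {i : ι} (hi : i ∈ s) :
    letters s T X x i = Sum.inl (T i (x ⟨i, hi⟩)) := dif_pos hi

theorem letters_of_notMem {ι : Type*} {E : ι → Type*} {𝒜 Z : Type*} {s : Set ι}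
    (T : ∀ i, E i → 𝒜) (X : ι → Z) (x : ∀ i : s, E i) {i : ι} (hi : i ∉ s) :
    letters s T X x i = Sum.inr (X i) := dif_neg hi

variable {n : ℕ} {E : Fin (n + 1) → Type*}
  [∀ i, AddCommGroup (E i)] [∀ i, Lattice (E i)] [∀ i, IsOrderedAddMonoid (E i)]
  [∀ i, Module ℝ (E i)] [∀ i, IsOrderedModule ℝ (E i)]
  {𝒜 : Type*} [NonUnitalRing 𝒜] [Lattice 𝒜] [IsOrderedAddMonoid 𝒜]
  [Module ℝ 𝒜] [IsOrderedModule ℝ 𝒜] [IsScalarTower ℝ 𝒜 𝒜] [SMulCommClass ℝ 𝒜 𝒜]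

theorem last_mem_remaining (ρ : Equiv.Perm (Fin (n + 1))) {k : ℕ} (hk : k ≤ n) :
    ρ (Fin.last n) ∈ remaining ρ k := by
  intro l hl h
  rw [ρ.injective h, Fin.val_last] at hl
  omega

theorem eq_last_of_mem_remaining (ρ : Equiv.Perm (Fin (n + 1))) {i : Fin (n + 1)}
    (hi : i ∈ remaining ρ n) : i = ρ (Fin.last n) := by
  obtain ⟨l, rfl⟩ := ρ.surjective i
  by_contra hne
  have : l ≠ Fin.last n := fun h => hne (by rw [h])
  exact hi l (Fin.val_lt_last this) rfl

theorem letters_fill {Z : Type*} (ρ : Equiv.Perm (Fin (n + 1))) (k : Fin (n + 1))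
    (T : ∀ i, E i → 𝒜) (X : Fin (n + 1) → Z) (x : ∀ i : remaining ρ (k + 1), E i)
    (z : E (ρ k)) {i : Fin (n + 1)} (hi : i ≠ ρ k) :
    letters (remaining ρ k) T X (fill (mem_of_remaining ρ k) x z) i =
      letters (remaining ρ (k + 1)) T X x i := by
  by_cases him : i ∈ remaining ρ k
  · rw [letters_of_mem _ _ _ him, letters_of_mem _ _ _ (mem_of_remaining ρ k i him hi),
      fill_of_ne _ _ _ _ hi]
  · rw [letters_of_notMem _ _ _ him,
      letters_of_notMem _ _ _ fun h => him (remaining_subset ρ k h)]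

/-- The image of `x''` under the second adjoints of the operators `T i`. -/
noncomputable def bidualTuple (T : ∀ i, E i →ₗ[ℝ] 𝒜) (hT : ∀ i, IsRegularLinear (T i))
    (x'' : ∀ i, RieszDual (RieszDual (E i))) (i : Fin (n + 1)) : RieszDual (RieszDual 𝒜) :=
  RieszDual.dualMap (RieszDual.dualMap (T i) (hT i)) (RieszDual.dualMap_isRegular _ _) (x'' i)

theorem stage_eq_word (hA : IsArchimedeanRiesz 𝒜) (hf : IsFAlgebra 𝒜)
    (T : ∀ i, E i →ₗ[ℝ] 𝒜) (hT : ∀ i, IsRegularLinear (T i))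
    (x'' : ∀ i, RieszDual (RieszDual (E i))) (ρ : Equiv.Perm (Fin (n + 1)))
    {Φ : RegularMultilinear E ℝ} {h : RieszDual 𝒜}
    (hΦ : ∀ x, Φ.1 x = h (orderedProduct n fun i => T i (x i))) (k : ℕ) (hk : k ≤ n)
    (x : ∀ i : remaining ρ k, E i) :
    (stage ρ x'' k (Nat.le_succ_of_le hk) Φ).1 x =
      hf.word hA (Finset.univ.erase (ρ (Fin.last n)))
        (letters (remaining ρ k) (fun i => T i) (bidualTuple T hT x'') x) h
        (T _ (x ⟨_, last_mem_remaining ρ hk⟩)) := by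
  induction k with
  | zero =>
    refine (start_apply ρ Φ x).trans ((hΦ _).trans
      ((hf.apply_orderedProduct hA n _ h (ρ (Fin.last n))).trans ?_))
    congr 1
    refine hf.word_congr hA (fun i _ => ?_) h
    exact (letters_of_mem (fun i => T i) (bidualTuple T hT x'') x (i := i)
      (remainingZero ρ i).2).symm
  | succ k ih =>
    have hkn : k < n + 1 := Nat.lt_of_succ_le (Nat.le_succ_of_le hk)
    set l : Fin (n + 1) := ⟨k, hkn⟩ with hl
    have hlj : ρ l ≠ ρ (Fin.last n) := fun e => by
      have := congrArg Fin.val (ρ.injective e)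
      simp only [hl, Fin.val_last] at this
      omega
    have hmem : ρ l ∈ Finset.univ.erase (ρ (Fin.last n)) :=
      Finset.mem_erase.2 ⟨hlj, Finset.mem_univ _⟩
    set a := T _ (x ⟨_, last_mem_remaining ρ hk⟩) with ha
    have hs : slice (mem_of_remaining ρ l) (mem_remaining ρ l)
        (stage ρ x'' k (Nat.le_succ_of_le (Nat.le_of_succ_le hk)) Φ) x =
        RieszDual.dualMap (T (ρ l)) (hT _) (hf.act a (hf.word hA
          ((Finset.univ.erase (ρ (Fin.last n))).erase (ρ l))
          (letters (remaining ρ (k + 1)) (fun i => T i) (bidualTuple T hT x'') x) h)) := by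
      ext z
      rw [slice_apply, ih (Nat.le_of_succ_le hk), hf.word_eq_letter hA hmem,
        letters_of_mem _ _ _ (mem_remaining ρ l), fill_self, fill_of_ne _ _ _ _ hlj.symm,
        hf.word_congr hA fun i hi => letters_fill ρ l _ _ x z (Finset.ne_of_mem_erase hi)]
      exact hf.apply_mul_comm _ _ _
    rw [hf.word_eq_letter hA hmem, letters_of_notMem _ _ _ (notMem_remaining ρ l)]
    exact congrArg (x'' (ρ l)) hs

theorem value_eq_word (hA : IsArchimedeanRiesz 𝒜) (hf : IsFAlgebra 𝒜)
    (T : ∀ i, E i →ₗ[ℝ] 𝒜) (hT : ∀ i, IsRegularLinear (T i))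
    (x'' : ∀ i, RieszDual (RieszDual (E i))) (ρ : Equiv.Perm (Fin (n + 1)))
    {Φ : RegularMultilinear E ℝ} {h : RieszDual 𝒜}
    (hΦ : ∀ x, Φ.1 x = h (orderedProduct n fun i => T i (x i))) :
    value ρ Φ x'' = bidualTuple T hT x'' (ρ (Fin.last n))
      (hf.word hA (Finset.univ.erase (ρ (Fin.last n)))
        (fun i => Sum.inr (bidualTuple T hT x'' i)) h) := by
  have hs : slice (mem_of_remaining ρ (Fin.last n)) (mem_remaining ρ (Fin.last n))
      (stage ρ x'' n (Nat.le_succ n) Φ) (isEmpty_remaining ρ).elim =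
      RieszDual.dualMap (T (ρ (Fin.last n))) (hT _)
        (hf.word hA (Finset.univ.erase (ρ (Fin.last n)))
          (fun i => Sum.inr (bidualTuple T hT x'' i)) h) := by
    ext z
    rw [slice_apply, stage_eq_word hA hf T hT x'' ρ hΦ n le_rfl, fill_self]
    rw [hf.word_congr hA fun i hi => letters_of_notMem _ _ _ fun him =>
      Finset.ne_of_mem_erase hi (eq_last_of_mem_remaining ρ him)]
    rfl
  exact congrArg (x'' (ρ (Fin.last n))) hs

theorem extension_eq_of_isFiniteSumOfMultiplicative (hA : IsArchimedeanRiesz 𝒜)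
    (hf : IsFAlgebra 𝒜) {A : RegularMultilinear E 𝒜} (h : IsFiniteSumOfMultiplicative A)
    (ρ σ : Equiv.Perm (Fin (n + 1))) : extension ρ A = extension σ A := by
  obtain ⟨N, B, hB, rfl⟩ := h
  ext x'' y'
  change value ρ (compose _ y') x'' = value σ (compose _ y') x''
  have hadd : ∀ (τ : Equiv.Perm (Fin (n + 1))) (s : Finset (Fin N)),
      value τ (compose (∑ k ∈ s, B k) y') x'' = ∑ k ∈ s, value τ (compose (B k) y') x'' := by
    intro τ s
    induction s using Finset.induction_on with
    | empty =>
      have e : compose (0 : RegularMultilinear E 𝒜) y' = (0 : ℝ) • compose 0 y' := by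
        rw [zero_smul]
        apply Subtype.ext
        ext x
        exact map_zero y'
      rw [Finset.sum_empty, Finset.sum_empty, e, value_smul, zero_mul]
    | insert k s hk ih =>
      rw [Finset.sum_insert hk, Finset.sum_insert hk, ← ih, ← value_add]
      congr 1
      congr 1
      apply Subtype.ext
      ext x
      exact map_add y' _ _
  rw [hadd, hadd]
  refine Finset.sum_congr rfl fun k _ => ?_
  obtain ⟨T, hT, hTB⟩ := hB k
  have hΦ : ∀ x, (compose (B k) y').1 x = y' (orderedProduct n fun i => T i (x i)) := fun x => by
    rw [compose_apply, hTB]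
  rw [value_eq_word hA hf T hT x'' ρ hΦ, value_eq_word hA hf T hT x'' σ hΦ]
  exact hf.apply_word_erase_inr hA _ _ _ _

end Arens

/-! ## Order continuity of adjoint-like operators -/

namespace RieszDual

section Pointwise

variable {E : Type*} [AddCommGroup E] [Lattice E] [IsOrderedAddMonoid E] [Module ℝ E]
  [IsOrderedModule ℝ E]

/-- A net in the order dual that decreases to zero decreases to zero pointwise. -/
theorem le_zero_of_decreasesToZero {Ω : Type*} [Preorder Ω] [IsDirectedOrder Ω] [Nonempty Ω]
    {y : Ω → RieszDual E} (hy : DecreasesToZero y) {x : E} (hx : 0 ≤ x) {M : ℝ}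
    (hM : ∀ α, M ≤ y α x) : M ≤ 0 := by
  have h0 : ∀ α, 0 ≤ y α := fun α => hy.2.1 ⟨α, rfl⟩
  have hlim : ∀ z : E, 0 ≤ z →
      Filter.Tendsto (fun α => y α z) Filter.atTop (nhds (⨅ α, y α z)) := fun z hz =>
    tendsto_atTop_ciInf (fun α β h => hy.1 h z hz)
      ⟨0, by rintro _ ⟨α, rfl⟩; exact h0 α z hz⟩
  have hlim' : ∀ z : E, Filter.Tendsto (fun α => y α z) Filter.atTop
      (nhds ((⨅ α, y α z⁺) - ⨅ α, y α z⁻)) := fun z => by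
    have := (hlim _ (posPart_nonneg z)).sub (hlim _ (negPart_nonneg z))
    simpa only [← map_sub, posPart_sub_negPart] using this
  let g : RieszDual E := ofNonneg
    { toFun := fun z => (⨅ α, y α z⁺) - ⨅ α, y α z⁻
      map_add' := fun z z' => tendsto_nhds_unique (hlim' (z + z')) (by
        simpa only [map_add] using (hlim' z).add (hlim' z'))
      map_smul' := fun c z => tendsto_nhds_unique (hlim' (c • z)) (by
        simpa only [map_smul, smul_eq_mul, RingHom.id_apply] using (hlim' z).const_mul c) }
    fun z hz => ge_of_tendsto' (hlim' z) fun α => h0 α z hz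
  have hg : g ≤ 0 := hy.2.2 (by
    rintro _ ⟨α, rfl⟩
    intro z hz
    refine le_of_tendsto (hlim' z) ?_
    filter_upwards [Filter.eventually_ge_atTop α] with β hβ using hy.1 hβ z hz)
  exact (ge_of_tendsto' (hlim' x) hM).trans (hg x hx)

end Pointwise

variable {E F : Type*} [AddCommGroup E] [Lattice E] [IsOrderedAddMonoid E] [Module ℝ E]
  [IsOrderedModule ℝ E] [AddCommGroup F] [Lattice F] [IsOrderedAddMonoid F] [Module ℝ F]
  [IsOrderedModule ℝ F]

/-- `T` is dominated by an operator `R` of the form `z ↦ z ∘ S` (on positive vectors) with a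
positive map `S`. -/
def IsAdjointDominated (T : RieszDual E →ₗ[ℝ] RieszDual F) : Prop :=
  ∃ (R : RieszDual E →ₗ[ℝ] RieszDual F) (S : F → E), (∀ f, 0 ≤ f → 0 ≤ S f) ∧
    (∀ z f, 0 ≤ f → R z f = z (S f)) ∧ ∀ z, |T z| ≤ R |z|

theorem IsAdjointDominated.exists_majorant {T : RieszDual E →ₗ[ℝ] RieszDual F}
    (hT : IsAdjointDominated T) : ∃ R : RieszDual E → RieszDual F,
      (∀ z y, |z| ≤ y → |T z| ≤ R y) ∧
      ∀ {Ω : Type w} [Preorder Ω] [IsDirectedOrder Ω] [Nonempty Ω] (y : Ω → RieszDual E),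
        DecreasesToZero y → DecreasesToZero fun α => R (y α) := by
  obtain ⟨R, S, hS, hRS, hTR⟩ := hT
  have hmono : ∀ a b, a ≤ b → R a ≤ R b := fun a b hab f hf => by
    rw [hRS _ _ hf, hRS _ _ hf]
    exact hab _ (hS f hf)
  refine ⟨R, fun z y hzy => (hTR z).trans (hmono _ _ hzy), fun y hy => ⟨fun α β h =>
    hmono _ _ (hy.1 h), ?_, ?_⟩⟩
  · rintro _ ⟨α, rfl⟩
    have := hmono _ _ (hy.2.1 ⟨α, rfl⟩)
    rwa [map_zero] at this
  · intro L hL f hf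
    refine le_zero_of_decreasesToZero hy (hS f hf) fun α => ?_
    rw [← hRS _ _ hf]
    exact hL ⟨α, rfl⟩ f hf

theorem IsAdjointDominated.isOrderContinuous {T : RieszDual E →ₗ[ℝ] RieszDual F}
    (hT : IsAdjointDominated T) : IsOrderContinuous.{w} T := by
  obtain ⟨R, hR, hR'⟩ := hT.exists_majorant
  rintro Ω _ _ _ x ⟨y, hy, hxy⟩
  simp only [sub_zero] at hxy
  refine ⟨_, hR' y hy, fun α => ?_⟩
  rw [sub_zero]
  exact hR _ _ (hxy α)

theorem IsAdjointDominated.isOneOrderContinuous {T : RieszDual E →ₗ[ℝ] RieszDual F}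
    (hT : IsAdjointDominated T) : IsOneOrderContinuous.{w} T := by
  obtain ⟨R, hR, hR'⟩ := hT.exists_majorant
  rintro Ω _ _ _ x ⟨y, α₀, hy, hxy⟩
  simp only [sub_zero] at hxy
  refine ⟨_, α₀, hR' y hy, fun α hα => ?_⟩
  rw [sub_zero]
  exact hR _ _ (hxy α hα)

theorem IsAdjointDominated.isTwoOrderContinuous {T : RieszDual E →ₗ[ℝ] RieszDual F}
    (hT : IsAdjointDominated T) : IsTwoOrderContinuous.{w, w'} T := by
  obtain ⟨R, hR, hR'⟩ := hT.exists_majorant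
  rintro Ω _ _ _ x ⟨Γ, _, _, _, y, hy, hxy⟩
  simp only [sub_zero] at hxy
  refine ⟨Γ, inferInstance, inferInstance, inferInstance, _, hR' y hy, fun β => ?_⟩
  obtain ⟨α₀, h⟩ := hxy β
  refine ⟨α₀, fun α hα => ?_⟩
  rw [sub_zero]
  exact hR _ _ (h α hα)

end RieszDual

namespace Arens

variable {n : ℕ} {E : Fin (n + 1) → Type*}
  [∀ i, AddCommGroup (E i)] [∀ i, Lattice (E i)] [∀ i, IsOrderedAddMonoid (E i)]
  [∀ i, Module ℝ (E i)] [∀ i, IsOrderedModule ℝ (E i)]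
  {F : Type*} [AddCommGroup F] [Lattice F] [IsOrderedAddMonoid F] [Module ℝ F]
  [IsOrderedModule ℝ F]

/-- The functional on the last variable to be eliminated. -/
noncomputable def lastSlice (ρ : Equiv.Perm (Fin (n + 1)))
    (x'' : ∀ i, RieszDual (RieszDual (E i))) (Φ : RegularMultilinear E ℝ) :
    RieszDual (E (ρ (Fin.last n))) :=
  slice (mem_of_remaining ρ (Fin.last n)) (mem_remaining ρ (Fin.last n))
    (stage ρ x'' n (Nat.le_succ n) Φ) (isEmpty_remaining ρ).elim

theorem value_update_last (ρ : Equiv.Perm (Fin (n + 1)))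
    (x'' : ∀ i, RieszDual (RieszDual (E i))) (Φ : RegularMultilinear E ℝ)
    (z : RieszDual (RieszDual (E (ρ (Fin.last n))))) :
    value ρ Φ (Function.update x'' (ρ (Fin.last n)) z) = z (lastSlice ρ x'' Φ) := by
  have h1 : value ρ Φ (Function.update x'' (ρ (Fin.last n)) z) =
      (Function.update x'' (ρ (Fin.last n)) z) (ρ (Fin.last n))
        (lastSlice ρ (Function.update x'' (ρ (Fin.last n)) z) Φ) := rfl
  have h2 : lastSlice ρ (Function.update x'' (ρ (Fin.last n)) z) Φ = lastSlice ρ x'' Φ := by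
    rw [lastSlice, lastSlice, stage_congr ρ (y'' := x'') n (Nat.le_succ n) fun l hl => ?_]
    refine Function.update_of_ne (fun e => ?_) _ _
    rw [ρ.injective e, Fin.val_last] at hl
    exact lt_irrefl _ hl
  rw [h1, h2, Function.update_self]

theorem lastSlice_nonneg (ρ : Equiv.Perm (Fin (n + 1)))
    {x'' : ∀ i, RieszDual (RieszDual (E i))} (hx'' : ∀ i, 0 ≤ x'' i)
    {Φ : RegularMultilinear E ℝ} (hΦ : IsPositiveMultilinear Φ.1) : 0 ≤ lastSlice ρ x'' Φ :=
  fun _ hz => stage_pos ρ hx'' hΦ n (Nat.le_succ n) _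
    (fill_nonneg _ (fun i => (isEmpty_remaining ρ).elim i) hz)

theorem isAdjointDominated_last (ρ : Equiv.Perm (Fin (n + 1))) (A : RegularMultilinear E F)
    (x'' : ∀ i, RieszDual (RieszDual (E i))) :
    RieszDual.IsAdjointDominated ((extension ρ A).toLinearMap x'' (ρ (Fin.last n))) := by
  obtain ⟨_, P, Q, hP, hQ, rfl⟩ := A
  set j := ρ (Fin.last n)
  let P' : RegularMultilinear E F := ⟨P, P, 0, hP, fun _ _ => le_rfl, by simp⟩
  let Q' : RegularMultilinear E F := ⟨Q, Q, 0, hQ, fun _ _ => le_rfl, by simp⟩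
  have hpos : ∀ (B : RegularMultilinear E F), IsPositiveMultilinear B.1 → ∀ y' : RieszDual F,
      0 ≤ y' → IsPositiveMultilinear (compose B y').1 := fun B hB y' hy' x hx => hy' _ (hB x hx)
  refine ⟨(extension ρ P' + extension ρ Q').toLinearMap (fun i => |x'' i|) j,
    fun y' => lastSlice ρ (fun i => |x'' i|) (compose P' y') +
      lastSlice ρ (fun i => |x'' i|) (compose Q' y'), fun y' hy' => ?_, fun z y' hy' => ?_,
    fun z => ?_⟩
  · exact add_nonneg (lastSlice_nonneg ρ (fun i => abs_nonneg _) (hpos P' hP y' hy'))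
      (lastSlice_nonneg ρ (fun i => abs_nonneg _) (hpos Q' hQ y' hy'))
  · rw [map_add, ← value_update_last, ← value_update_last]
    rfl
  · have key : ∀ y' : RieszDual F, 0 ≤ y' →
        |extension ρ ⟨P - Q, P, Q, hP, hQ, rfl⟩ (Function.update x'' j z) y'| ≤
          extension ρ P' (Function.update (fun i => |x'' i|) j |z|) y' +
          extension ρ Q' (Function.update (fun i => |x'' i|) j |z|) y' := by
      intro y' hy'
      have hc : compose ⟨P - Q, P, Q, hP, hQ, rfl⟩ y' + compose Q' y' = compose P' y' := by
        apply Subtype.ext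
        ext x
        change y' (P x - Q x) + y' (Q x) = y' (P x)
        rw [map_sub, sub_add_cancel]
      have he : value ρ (compose ⟨P - Q, P, Q, hP, hQ, rfl⟩ y') (Function.update x'' j z) =
          value ρ (compose P' y') (Function.update x'' j z) -
            value ρ (compose Q' y') (Function.update x'' j z) := by
        rw [← hc, value_add, add_sub_cancel_right]
      have hu : (fun i => |Function.update x'' j z i|) =
          Function.update (fun i => |x'' i|) j |z| := by
        ext1 i
        rcases eq_or_ne i j with rfl | hi
        · simp
        · simp [Function.update_of_ne hi]
      have h1 := (value_pos ρ (hpos P' hP y' hy')).abs_apply_le (Function.update x'' j z)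
      have h2 := (value_pos ρ (hpos Q' hQ y' hy')).abs_apply_le (Function.update x'' j z)
      rw [hu] at h1 h2
      change |value ρ _ _| ≤ value ρ _ _ + value ρ _ _
      rw [he]
      exact (abs_sub _ _).trans (add_le_add h1 h2)
    exact abs_le'.2 ⟨fun y' hy' => (le_abs_self _).trans (key y' hy'),
      fun y' hy' => (neg_le_abs _).trans (key y' hy')⟩

end Arens

theorem mainTheorem3 {n : ℕ} {E : Fin (n + 1) → Type u}
    [∀ i, AddCommGroup (E i)] [∀ i, Lattice (E i)] [∀ i, IsOrderedAddMonoid (E i)]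
    [∀ i, Module ℝ (E i)] [∀ i, IsOrderedModule ℝ (E i)]
    {𝒜 : Type v} [NonUnitalRing 𝒜] [Lattice 𝒜] [IsOrderedAddMonoid 𝒜]
    [Module ℝ 𝒜] [IsOrderedModule ℝ 𝒜] [IsScalarTower ℝ 𝒜 𝒜] [SMulCommClass ℝ 𝒜 𝒜]
    (hArch : IsArchimedeanRiesz 𝒜) (hf : IsFAlgebra 𝒜)
    (A : RegularMultilinear E 𝒜) (hA : IsFiniteSumOfMultiplicative A) :
    (∀ ρ σ : Equiv.Perm (Fin (n + 1)), Arens.extension ρ A = Arens.extension σ A) ∧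
    ∀ ρ : Equiv.Perm (Fin (n + 1)),
      IsSeparatelyOrderContinuous.{w} (Arens.extension ρ A) ∧
      IsSeparatelyOneOrderContinuous.{w} (Arens.extension ρ A) ∧
      IsSeparatelyTwoOrderContinuous.{w, w'} (Arens.extension ρ A) := by
  have hreg := fun ρ σ => Arens.extension_eq_of_isFiniteSumOfMultiplicative hArch hf hA ρ σ
  have hdom : ∀ (ρ : Equiv.Perm (Fin (n + 1))) (x'' : ∀ i, RieszDual (RieszDual (E i)))
      (j : Fin (n + 1)),
      RieszDual.IsAdjointDominated ((Arens.extension ρ A).toLinearMap x'' j) := by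
    intro ρ x'' j
    obtain ⟨σ, rfl⟩ : ∃ σ : Equiv.Perm (Fin (n + 1)), σ (Fin.last n) = j :=
      ⟨Equiv.swap (Fin.last n) j, Equiv.swap_apply_left _ _⟩
    rw [hreg ρ σ]
    exact Arens.isAdjointDominated_last σ A x''
  exact ⟨hreg, fun ρ => ⟨fun x'' j => (hdom ρ x'' j).isOrderContinuous,
    fun x'' j => (hdom ρ x'' j).isOneOrderContinuous,
    fun x'' j => (hdom ρ x'' j).isTwoOrderContinuous⟩⟩
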